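/- Let $X$ be a Banach space over $\mathbb K=\mathbb R$ or $\mathbb C$. Let $\cot X\in[2,\infty]$ be the infimum of the cotypes $q\in[2,\infty]$ of $X$ (every space has cotype $\infty$), and for $1<q\le\infty$ let $q^*$ be the conjugate exponent, $\frac1q+\frac1{q^*}=1$ (so $\infty^*=1$). For real $r>0$, a continuous bilinear form $A:X\times X\to\mathbb K$ is called $r$-dominated if $\sum_{j=1}^\infty|A(x_j,y_j)|^{r/2}<\infty$ whenever the sequences $(x_j)_{j=1}^\infty,(y_j)_{j=1}^\infty$ in $X$ are weakly $r$-summable, that is, $\sum_{j=1}^\infty|\varphi(x_j)|^r<\infty$ and $\sum_{j=1}^\infty|\varphi(y_j)|^r<\infty$ for every continuous linear functional $\varphi$ on $X$. Put $$\mathcal L_X:=\inf\{r>0:\ \text{every continuous bilinear form on }X\times X\text{ is }r\text{-dominated}\}\in[0,\infty],\qquad \inf\emptyset=\infty .$$ If $\cot X>2$, then $\mathcal L_X\ge(\cot X)^*$. In particular, for every real $r$ with $1\le r<(\cot X)^*$ there is a continuous bilinear form on $X\times X$ that is not $r$-dominated. -/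

import Mathlib

open scoped ENNReal

namespace DominatedForms

/-- `X` has cotype `q`: there is a constant `C` with
`(∑ j, ‖x j‖ ^ q) ^ (1 / q) ≤ C * (E ‖∑ j, ε j • x j‖ ^ 2) ^ (1 / 2)` for all finite families,
where the expectation is the average over all `2 ^ n` choices of signs `ε j = ± 1`
(this is the Rademacher average `∫ t in 0..1, ‖∑ j, r_j(t) • x j‖ ^ 2`). -/
def HasCotype (X : Type*) [NormedAddCommGroup X] (q : ℝ) : Prop :=
  ∃ C : ℝ, ∀ (n : ℕ) (x : Fin n → X),
    (∑ j, ‖x j‖ ^ q) ^ (1 / q) ≤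
      C * √((2 ^ n : ℝ)⁻¹ * ∑ ε : Fin n → ℤˣ, ‖∑ j, (ε j : ℤ) • x j‖ ^ 2)

/-- `cot X`, the infimum of the cotypes `q ∈ [2, ∞]` of `X`. Every normed space has
cotype `∞`, so the value is `∞` when `X` has no finite cotype. -/
noncomputable def cot (X : Type*) [NormedAddCommGroup X] : ℝ≥0∞ :=
  ⨅ (q : ℝ) (_ : 2 ≤ q ∧ HasCotype X q), ENNReal.ofReal q

section

variable {𝕜 X : Type*} [RCLike 𝕜] [NormedAddCommGroup X] [NormedSpace 𝕜 X]

/-- The sequence `x` is weakly `r`-summable: `(φ (x j))_j ∈ ℓ_r` for every continuous linear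
functional `φ` on `X`. -/
def WeaklySummable (𝕜 : Type*) {X : Type*} [RCLike 𝕜] [NormedAddCommGroup X] [NormedSpace 𝕜 X]
    (r : ℝ) (x : ℕ → X) : Prop :=
  ∀ φ : X →L[𝕜] 𝕜, Summable fun j => ‖φ (x j)‖ ^ r

/-- The continuous bilinear form `A` on `X × X` is absolutely `(p; q)`-summing. -/
def AbsolutelySumming (p q : ℝ) (A : X →L[𝕜] X →L[𝕜] 𝕜) : Prop :=
  ∀ x y : ℕ → X, WeaklySummable 𝕜 q x → WeaklySummable 𝕜 q y →
    Summable fun j => ‖A (x j) (y j)‖ ^ p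

/-- The continuous bilinear form `A` on `X × X` is `r`-dominated: it is absolutely
`(r / 2; r)`-summing. -/
def IsDominated (r : ℝ) (A : X →L[𝕜] X →L[𝕜] 𝕜) : Prop :=
  AbsolutelySumming (r / 2) r A

end

/-- The infimum of all `r > 0` such that every continuous bilinear form on `X × X` is
`r`-dominated; it is `∞` when there is no such `r`. -/
noncomputable def dominationIndex (𝕜 X : Type*) [RCLike 𝕜] [NormedAddCommGroup X]
    [NormedSpace 𝕜 X] : ℝ≥0∞ :=
  ⨅ (r : ℝ) (_ : 0 < r ∧ ∀ A : X →L[𝕜] X →L[𝕜] 𝕜, IsDominated r A), ENNReal.ofReal r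

end DominatedForms

/-! The argument gives more than is asked: if `cot X > 2`, then for every 0 < r < 2 some form is not
r-dominated. This suffices because the conjugate of an exponent ≥ 2 is at most 2.

Suppose x_1, ..., x_M have norm at least 1 and ∑|φ(x_i)|^r ≤ C‖φ‖^r M^γ for every functional φ. If
all forms were r-dominated, uniform boundedness, applied to a sequence made of rescaled blocks of
this kind, would bound ∑|A(x_i,x_i)|^(r/2) essentially by M^γ ‖A‖^(r/2). Test this on A = ∑ ±φ_j ⊗
φ_j, where φ_j norms x_j: ‖A‖ ≤ M, while each |A(x_i,x_i)|^(r/2) is at least 1/2 on average over the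
signs. Thus M is at most of order M^(γ+r/2), which is absurd for large M if γ < 1 - r/2
(`exists_not_isDominated`).

Such vectors exist once all subfamilies K satisfy `signMax x K` ≤ C|K|^(1/t) with some t > 2: the
decreasing rearrangement of |φ(x_i)| is then O(k^(1/t-1)), so γ = 1 - r(1 - 1/t) works when this is
positive. The engine is `exists_hereditary_family`, which turns the failure of an ℓ_s estimate into
long families of comparable norms whose subfamilies all satisfy the reverse estimate. It is used
twice. Failure of cotype s > 2 first gives families with small Rademacher averages; repeated halving
(`exists_half_signMax_le`) replaces averages by maxima over signs, but only for the final subfamily.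
This already refutes the ℓ_t estimate for `signMax` when t < s, and a second extraction makes the
bound hereditary again. -/

namespace DominatedForms

/-! ### Signed sums: Rademacher averages and maxima over signs -/

section Signs

variable {X : Type*} [NormedAddCommGroup X] {n : ℕ}

/-- The signed sum `∑ i ∈ K, ε i • x i`. -/
def signedSum (x : Fin n → X) (K : Finset (Fin n)) (ε : Fin n → ℤˣ) : X :=
  ∑ i ∈ K, (ε i : ℤ) • x i

/-- The quadratic Rademacher average of the subfamily `(x i)_{i ∈ K}`. -/
noncomputable def radAvg (x : Fin n → X) (K : Finset (Fin n)) : ℝ :=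
  √((2 ^ n : ℝ)⁻¹ * ∑ ε : Fin n → ℤˣ, ‖signedSum x K ε‖ ^ 2)

/-- The largest norm of a signed sum of the subfamily `(x i)_{i ∈ K}`. -/
noncomputable def signMax (x : Fin n → X) (K : Finset (Fin n)) : ℝ :=
  ⨆ ε : Fin n → ℤˣ, ‖signedSum x K ε‖

theorem card_signs (n : ℕ) : Fintype.card (Fin n → ℤˣ) = 2 ^ n := by simp

theorem sum_signs_mul (δ : Fin n → ℤˣ) (f : (Fin n → ℤˣ) → ℝ) :
    ∑ ε, f (ε * δ) = ∑ ε, f ε :=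
  Equiv.sum_comp (Equiv.mulRight δ) f

theorem le_signMax (x : Fin n → X) (K : Finset (Fin n)) (ε : Fin n → ℤˣ) :
    ‖signedSum x K ε‖ ≤ signMax x K :=
  le_ciSup (f := fun ε => ‖signedSum x K ε‖) (Set.finite_range _).bddAbove ε

theorem exists_eq_signMax (x : Fin n → X) (K : Finset (Fin n)) :
    ∃ ε, ‖signedSum x K ε‖ = signMax x K :=
  exists_eq_ciSup_of_finite (f := fun ε => ‖signedSum x K ε‖)

theorem signMax_nonneg (x : Fin n → X) (K : Finset (Fin n)) : 0 ≤ signMax x K :=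
  (norm_nonneg _).trans (le_signMax x K 1)

theorem radAvg_nonneg (x : Fin n → X) (K : Finset (Fin n)) : 0 ≤ radAvg x K :=
  Real.sqrt_nonneg _

theorem radAvg_sq (x : Fin n → X) (K : Finset (Fin n)) :
    radAvg x K ^ 2 = (2 ^ n : ℝ)⁻¹ * ∑ ε : Fin n → ℤˣ, ‖signedSum x K ε‖ ^ 2 :=
  Real.sq_sqrt (by positivity)

theorem norm_units_smul (u : ℤˣ) (x : X) : ‖(u : ℤ) • x‖ = ‖x‖ := by
  rcases Int.units_eq_one_or u with rfl | rfl <;> simp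

theorem norm_signedSum_singleton (x : Fin n → X) (i : Fin n) (ε : Fin n → ℤˣ) :
    ‖signedSum x {i} ε‖ = ‖x i‖ := by
  simp [signedSum, norm_units_smul]

/-- The average of the norms of the signed sums is at most their quadratic average. -/
theorem sum_norm_signedSum_le (x : Fin n → X) (K : Finset (Fin n)) :
    ∑ ε, ‖signedSum x K ε‖ ≤ 2 ^ n * radAvg x K := by
  have h := sq_sum_le_card_mul_sum_sq (s := (Finset.univ : Finset (Fin n → ℤˣ)))
    (f := fun ε => ‖signedSum x K ε‖)
  rw [Finset.card_univ, card_signs] at h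
  refine abs_le_of_sq_le_sq' ?_ (mul_nonneg (by positivity) (radAvg_nonneg x K)) |>.2
  rw [mul_pow, radAvg_sq]
  refine h.trans (le_of_eq ?_)
  push_cast
  field_simp

/-- Splitting the index set by labels `l` and attaching independent signs to the blocks. -/
theorem signedSum_blocks (x : Fin n → X) (U : Finset (Fin n)) (l : Fin n → Fin n)
    (ε : Fin n → Fin n → ℤˣ) (η : Fin n → ℤˣ) :
    signedSum (fun j => signedSum x (U.filter (l · = j)) (ε j)) Finset.univ η
      = signedSum x U (fun i => η (l i) * ε (l i) i) := by
  unfold signedSum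
  rw [← Finset.sum_fiberwise U l fun i => ((η (l i) * ε (l i) i : ℤˣ) : ℤ) • x i]
  refine Finset.sum_congr rfl fun j _ => ?_
  rw [Finset.smul_sum]
  refine Finset.sum_congr rfl fun i hi => ?_
  rw [(Finset.mem_filter.1 hi).2, Units.val_mul, mul_smul]

/-- Replace each block by its maximal signed sum; any signed sum of these is again a signed sum over
U. -/
theorem signMax_blocks (x : Fin n → X) {s c : ℝ} (hs : 0 ≤ s) (hc : 0 ≤ c)
    (h : ∀ y : Fin n → X, ∑ j, ‖y j‖ ^ s ≤ c * signMax y Finset.univ ^ s)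
    (U : Finset (Fin n)) (l : Fin n → Fin n) :
    ∑ j, signMax x (U.filter (l · = j)) ^ s ≤ c * signMax x U ^ s := by
  choose ε hε using fun j => exists_eq_signMax x (U.filter (l · = j))
  have := h fun j => signedSum x (U.filter (l · = j)) (ε j)
  simp only [hε] at this
  refine this.trans (mul_le_mul_of_nonneg_left ?_ hc)
  refine Real.rpow_le_rpow (signMax_nonneg _ _) (ciSup_le fun η => ?_) hs
  rw [signedSum_blocks]
  exact le_signMax _ _ _

theorem rpow_sum_rpow_sum_le {ι κ : Type*} [Fintype ι] [Fintype κ] {p : ℝ} (hp : 1 ≤ p)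
    (a : ι → κ → ℝ) (ha : ∀ i k, 0 ≤ a i k) :
    (∑ k, (∑ i, a i k) ^ p) ^ (1 / p) ≤ ∑ i, (∑ k, a i k ^ p) ^ (1 / p) := by
  have : Fact (1 ≤ ENNReal.ofReal p) := ⟨by simpa using hp⟩
  have hpt : (ENNReal.ofReal p).toReal = p := ENNReal.toReal_ofReal (by linarith)
  have h := norm_sum_le (Finset.univ : Finset ι)
    (fun i => (WithLp.toLp (ENNReal.ofReal p) (a i) : PiLp (ENNReal.ofReal p) fun _ : κ => ℝ))
  have hn : ∀ v : κ → ℝ, (∀ k, 0 ≤ v k) →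
      ‖(WithLp.toLp (ENNReal.ofReal p) v : PiLp (ENNReal.ofReal p) fun _ : κ => ℝ)‖
        = (∑ k, v k ^ p) ^ (1 / p) := by
    intro v hv
    rw [PiLp.norm_eq_sum (by rw [hpt]; linarith), hpt]
    simp [abs_of_nonneg (hv _)]
  rw [← WithLp.toLp_sum, hn _ (fun k => by simpa using Finset.sum_nonneg fun i _ => ha i k)] at h
  simp only [hn _ (ha _), Finset.sum_apply] at h
  exact h

/-- The hypothesis is applied to the block sums for each fixed inner sign vector. Minkowski's
inequality in ℓ_(s/2), hence s ≥ 2, then averages over these vectors, and the product of block signs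
with inner signs is again uniformly distributed. -/
theorem radAvg_blocks (x : Fin n → X) {s c : ℝ} (hs : 2 ≤ s) (hc : 0 ≤ c)
    (h : ∀ y : Fin n → X, ∑ j, ‖y j‖ ^ s ≤ c * radAvg y Finset.univ ^ s)
    (U : Finset (Fin n)) (l : Fin n → Fin n) :
    ∑ j, radAvg x (U.filter (l · = j)) ^ s ≤ c * radAvg x U ^ s := by
  have hs0 : 0 < s := by linarith
  have hpow : ∀ a : ℝ, 0 ≤ a → (a ^ 2) ^ (s / 2) = a ^ s := fun a ha => by
    rw [← Real.rpow_natCast, ← Real.rpow_mul ha]; congr 1; push_cast; ring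
  have hpow' : ∀ a : ℝ, 0 ≤ a → (a ^ s) ^ (1 / (s / 2)) = a ^ 2 := fun a ha => by
    rw [← Real.rpow_mul ha, ← Real.rpow_natCast]; congr 1; push_cast; field_simp
  set y : (Fin n → ℤˣ) → Fin n → X := fun ε j => signedSum x (U.filter (l · = j)) ε with hy
  have h1 := rpow_sum_rpow_sum_le (p := s / 2) (by linarith)
    (fun (ε : Fin n → ℤˣ) j => (2 ^ n : ℝ)⁻¹ * ‖y ε j‖ ^ 2) (fun _ _ => by positivity)
  have h2 : ∀ ε, (∑ j, ((2 ^ n : ℝ)⁻¹ * ‖y ε j‖ ^ 2) ^ (s / 2)) ^ (1 / (s / 2))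
      ≤ (2 ^ n : ℝ)⁻¹ * (c ^ (1 / (s / 2)) * radAvg (y ε) Finset.univ ^ 2) := by
    intro ε
    have e1 : ∀ j, ((2 ^ n : ℝ)⁻¹ * ‖y ε j‖ ^ 2) ^ (s / 2)
        = ((2 ^ n : ℝ)⁻¹) ^ (s / 2) * ‖y ε j‖ ^ s := fun j => by
      rw [Real.mul_rpow (by positivity) (by positivity), hpow _ (norm_nonneg _)]
    simp only [e1]
    rw [← Finset.mul_sum, Real.mul_rpow (by positivity)
      (Finset.sum_nonneg fun _ _ => by positivity), ← Real.rpow_mul (by positivity),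
      mul_one_div_cancel (by linarith), Real.rpow_one]
    refine mul_le_mul_of_nonneg_left ?_ (by positivity)
    rw [← hpow' _ (radAvg_nonneg _ _), ← Real.mul_rpow hc
      (Real.rpow_nonneg (radAvg_nonneg _ _) _)]
    exact Real.rpow_le_rpow (Finset.sum_nonneg fun _ _ => by positivity) (h _) (by positivity)
  have h3 : ∑ ε, radAvg (y ε) Finset.univ ^ 2 = 2 ^ n * radAvg x U ^ 2 := by
    simp only [radAvg_sq, hy]
    rw [← Finset.mul_sum, Finset.sum_comm]
    have : ∀ η : Fin n → ℤˣ, ∑ ε : Fin n → ℤˣ,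
        ‖signedSum (fun j => signedSum x (U.filter (l · = j)) ε) Finset.univ η‖ ^ 2
        = ∑ ε, ‖signedSum x U ε‖ ^ 2 := fun η => by
      rw [← sum_signs_mul (fun i => η (l i)) fun ε => ‖signedSum x U ε‖ ^ 2]
      refine Finset.sum_congr rfl fun ε _ => ?_
      rw [signedSum_blocks x U l (fun _ => ε) η]
      congr 3
      funext i
      simp [mul_comm]
    simp only [this, Finset.sum_const, Finset.card_univ, card_signs, nsmul_eq_mul]
    push_cast
    ring
  have h4 : (∑ j, radAvg x (U.filter (l · = j)) ^ s) ^ (1 / (s / 2))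
      ≤ (c * radAvg x U ^ s) ^ (1 / (s / 2)) := by
    have e : ∀ j, (∑ ε : Fin n → ℤˣ, (2 ^ n : ℝ)⁻¹ * ‖y ε j‖ ^ 2) ^ (s / 2)
        = radAvg x (U.filter (l · = j)) ^ s := fun j => by
      rw [← Finset.mul_sum, ← hpow _ (radAvg_nonneg _ _), radAvg_sq]
    simp only [e] at h1
    refine h1.trans ((Finset.sum_le_sum fun ε _ => h2 ε).trans (le_of_eq ?_))
    rw [← Finset.mul_sum, ← Finset.mul_sum, h3, Real.mul_rpow hc
      (Real.rpow_nonneg (radAvg_nonneg _ _) _), hpow' _ (radAvg_nonneg _ _)]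
    field_simp
  refine (Real.rpow_le_rpow_iff ?_ ?_ (by positivity : 0 < 1 / (s / 2))).1 h4
  · exact Finset.sum_nonneg fun _ _ => Real.rpow_nonneg (radAvg_nonneg _ _) _
  · exact mul_nonneg hc (Real.rpow_nonneg (radAvg_nonneg _ _) _)

variable [NormedSpace ℝ X]

/-- Flipping the signs off K and adding cancels everything outside K. Monotonicity in the index set
follows for both quantities. -/
theorem two_mul_norm_signedSum_le (x : Fin n → X) {K L : Finset (Fin n)} (h : K ⊆ L) :
    ∃ δ : Fin n → ℤˣ, ∀ ε,
      2 * ‖signedSum x K ε‖ ≤ ‖signedSum x L ε‖ + ‖signedSum x L (ε * δ)‖ := by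
  classical
  refine ⟨fun i => if i ∈ K then 1 else -1, fun ε => ?_⟩
  have e : signedSum x L ε + signedSum x L (ε * fun i => if i ∈ K then 1 else -1)
      = (2 : ℝ) • signedSum x K ε := by
    rw [two_smul]
    unfold signedSum
    rw [← Finset.sum_add_distrib, ← Finset.sum_add_distrib]
    symm
    apply Finset.sum_subset_zero_on_sdiff h
    · intro i hi
      simp [(Finset.mem_sdiff.1 hi).2]
    · intro i hi
      simp [hi]
  calc 2 * ‖signedSum x K ε‖ = ‖(2 : ℝ) • signedSum x K ε‖ := by simp [norm_smul]
    _ ≤ _ := by rw [← e]; exact norm_add_le _ _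

theorem signMax_mono (x : Fin n → X) {K L : Finset (Fin n)} (h : K ⊆ L) :
    signMax x K ≤ signMax x L := by
  obtain ⟨δ, hδ⟩ := two_mul_norm_signedSum_le x h
  obtain ⟨ε, hε⟩ := exists_eq_signMax x K
  have := hδ ε
  have := le_signMax x L ε
  have := le_signMax x L (ε * δ)
  linarith

theorem radAvg_mono (x : Fin n → X) {K L : Finset (Fin n)} (h : K ⊆ L) :
    radAvg x K ≤ radAvg x L := by
  obtain ⟨δ, hδ⟩ := two_mul_norm_signedSum_le x h
  refine Real.sqrt_le_sqrt (mul_le_mul_of_nonneg_left ?_ (by positivity))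
  have key : ∑ ε, 2 * ‖signedSum x K ε‖ ^ 2
      ≤ ∑ ε, (‖signedSum x L ε‖ ^ 2 + ‖signedSum x L (ε * δ)‖ ^ 2) := by
    refine Finset.sum_le_sum fun ε _ => ?_
    have := hδ ε
    have h0 := norm_nonneg (signedSum x K ε)
    nlinarith [sq_nonneg (‖signedSum x L ε‖ - ‖signedSum x L (ε * δ)‖)]
  rw [Finset.sum_add_distrib, sum_signs_mul δ fun ε => ‖signedSum x L ε‖ ^ 2,
    ← Finset.mul_sum] at key
  linarith

theorem norm_le_radAvg (x : Fin n → X) (i : Fin n) : ‖x i‖ ≤ radAvg x Finset.univ := by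
  refine le_trans (le_of_eq ?_) (radAvg_mono x (Finset.subset_univ {i}))
  rw [radAvg]
  simp [norm_signedSum_singleton]

theorem norm_le_signMax (x : Fin n → X) (i : Fin n) : ‖x i‖ ≤ signMax x Finset.univ := by
  refine le_trans (le_of_eq ?_) ((le_signMax x {i} 1).trans
    (signMax_mono x (Finset.subset_univ {i})))
  rw [norm_signedSum_singleton]

end Signs

/-! ### Extraction of hereditary families -/

/-- Disjoint nonempty sets with property `P` (the fibres of `l` on `U`) can be removed from
`Fin n` until no nonempty set with property `P` is left. -/
theorem exists_exhaustion {n : ℕ} (P : Finset (Fin n) → Prop) :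
    ∃ (U : Finset (Fin n)) (l : Fin n → Fin n),
      (∀ j, U.filter (l · = j) = ∅ ∨ P (U.filter (l · = j))) ∧
        ∀ K ⊆ Uᶜ, K.Nonempty → ¬ P K := by
  classical
  -- Labels are required to stay in U, so an element of a new set K disjoint from U is an unused
  -- label for K.
  let Q : Finset (Fin n) → Prop := fun U => ∃ l : Fin n → Fin n, (∀ i ∈ U, l i ∈ U) ∧
    ∀ j, U.filter (l · = j) = ∅ ∨ P (U.filter (l · = j))
  have hne : (Finset.univ.filter Q).Nonempty := ⟨∅, Finset.mem_filter.2 ⟨Finset.mem_univ _, id, by simp, by simp⟩⟩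
  obtain ⟨U, hU, hmax⟩ := Finset.exists_max_image _ Finset.card hne
  obtain ⟨l, hl, hP⟩ := (Finset.mem_filter.1 hU).2
  refine ⟨U, l, hP, fun K hK ⟨k, hk⟩ hPK => ?_⟩
  have hdis : ∀ i ∈ K, i ∉ U := fun i hi => Finset.mem_compl.1 (hK hi)
  have hQ : Q (U ∪ K) := by
    refine ⟨fun i => if i ∈ K then k else l i, fun i hi => ?_, fun j => ?_⟩
    · by_cases hiK : i ∈ K
      · simp [hiK, hk]
      · have := (Finset.mem_union.1 hi).resolve_right hiK
        simp [hiK, hl i this]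
    · by_cases hj : j = k
      · right
        convert hPK using 1
        ext i
        simp only [Finset.mem_filter, Finset.mem_union]
        constructor
        · rintro ⟨hi, h⟩
          by_contra hiK
          have hiU := hi.resolve_right hiK
          rw [if_neg hiK] at h
          exact hdis k hk (hj ▸ h ▸ hl i hiU)
        · intro hi
          simp [hi, hj]
      · convert hP j using 2 <;>
        · ext i
          simp only [Finset.mem_filter, Finset.mem_union]
          by_cases hiK : i ∈ K
          · simp [hiK, hdis i hiK, Ne.symm hj]
          · simp [hiK]
  have h1 := hmax (U ∪ K) (by simpa using hQ)
  have h2 : U.card < (U ∪ K).card :=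
    Finset.card_lt_card ⟨Finset.subset_union_left, fun h =>
      hdis k hk (h (Finset.mem_union_right _ hk))⟩
  omega

/-- If each dyadic level of `v ≤ a` has at most `M` elements, then `∑ v ^ s ≤ 2 M a ^ s`. -/
theorem sum_rpow_le_of_card_level_le {ι : Type*} [DecidableEq ι] {s : ℝ} (hs : 1 ≤ s) (M : ℕ)
    (v : ι → ℝ) (hv : ∀ i, 0 ≤ v i) (V : Finset ι)
    (hM : ∀ τ : ℝ, 0 < τ → (V.filter fun i => τ < v i ∧ v i ≤ 2 * τ).card ≤ M)
    {a : ℝ} (ha : ∀ i ∈ V, v i ≤ a) (ha0 : 0 ≤ a) : ∑ i ∈ V, v i ^ s ≤ 2 * M * a ^ s := by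
  induction V using Finset.strongInduction generalizing a with
  | H V ih =>
  rcases V.eq_empty_or_nonempty with rfl | hne
  · simp; positivity
  obtain ⟨k, hk, hmax⟩ := Finset.exists_max_image V v hne
  rcases (hv k).eq_or_lt with h0 | hpos
  · rw [Finset.sum_eq_zero]
    · positivity
    · intro i hi
      rw [le_antisymm (h0 ▸ hmax i hi) (hv i), Real.zero_rpow (by linarith)]
  -- The top dyadic level; every remaining value is at most half the maximum, so the induction sums
  -- a geometric series.
  set T := V.filter fun i => v k / 2 < v i ∧ v i ≤ 2 * (v k / 2) with hT
  have hTV : T ⊆ V := Finset.filter_subset _ _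
  have hkT : k ∈ T := by simp [hT, hk]; constructor <;> linarith
  have h1 : ∑ i ∈ T, v i ^ s ≤ M * v k ^ s := by
    calc ∑ i ∈ T, v i ^ s ≤ ∑ i ∈ T, v k ^ s :=
          Finset.sum_le_sum fun i hi =>
            Real.rpow_le_rpow (hv i) (hmax i (hTV hi)) (by linarith)
      _ = T.card * v k ^ s := by simp
      _ ≤ M * v k ^ s := by
          have : (T.card : ℝ) ≤ M := by exact_mod_cast hM _ (half_pos hpos)
          gcongr
  have h2 : ∑ i ∈ V \ T, v i ^ s ≤ 2 * M * (v k / 2) ^ s := by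
    refine ih (V \ T) ⟨Finset.sdiff_subset, fun h =>
      (Finset.mem_sdiff.1 (h hk)).2 hkT⟩ (fun τ hτ => ?_) (fun i hi => ?_) (by positivity)
    · exact (Finset.card_le_card (Finset.filter_subset_filter _ Finset.sdiff_subset)).trans
        (hM τ hτ)
    · obtain ⟨hiV, hiT⟩ := Finset.mem_sdiff.1 hi
      by_contra hlt
      exact hiT (Finset.mem_filter.2 ⟨hiV, not_le.1 hlt, by linarith [hmax i hiV]⟩)
  have h3 : (v k / 2) ^ s ≤ v k ^ s / 2 := by
    rw [Real.div_rpow hpos.le (by norm_num)]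
    refine div_le_div_of_nonneg_left (by positivity) (by norm_num) ?_
    simpa using Real.rpow_le_rpow_of_exponent_le (by norm_num : (1 : ℝ) ≤ 2) hs
  have h4 : v k ^ s ≤ a ^ s := Real.rpow_le_rpow hpos.le (ha k hk) (by linarith)
  rw [← Finset.sum_sdiff hTV]
  have hM0 : (0 : ℝ) ≤ M := by positivity
  nlinarith [mul_le_mul_of_nonneg_left h3 hM0, mul_le_mul_of_nonneg_left h4 hM0]

/-- If `∑ ‖x i‖ ^ s ≤ C * F x ^ s` fails for every `C`, then there are arbitrarily long families
of vectors of almost equal norms `τ` with `F x ≤ C * τ * |K| ^ (1 / s)` for all subfamilies. -/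
theorem exists_hereditary_family {X : Type*} [NormedAddCommGroup X] {s : ℝ} (hs : 1 ≤ s)
    (F : ∀ {n : ℕ}, (Fin n → X) → Finset (Fin n) → ℝ)
    (h0 : ∀ {n} (x : Fin n → X) K, 0 ≤ F x K)
    (hmono : ∀ {n} (x : Fin n → X) K L, K ⊆ L → F x K ≤ F x L)
    (hnorm : ∀ {n} (x : Fin n → X) i, ‖x i‖ ≤ F x Finset.univ)
    (hblock : ∀ {n} (c : ℝ), 0 ≤ c →
      (∀ y : Fin n → X, ∑ j, ‖y j‖ ^ s ≤ c * F y Finset.univ ^ s) →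
      ∀ (x : Fin n → X) (U : Finset (Fin n)) (l : Fin n → Fin n),
        ∑ j, F x (U.filter (l · = j)) ^ s ≤ c * F x U ^ s)
    (hfail : ∀ C : ℝ, ∃ (n : ℕ) (x : Fin n → X), C * F x Finset.univ ^ s < ∑ i, ‖x i‖ ^ s)
    (M : ℕ) :
    ∃ (n : ℕ) (x : Fin n → X) (S : Finset (Fin n)) (τ : ℝ), 0 < τ ∧ M < S.card ∧
      (∀ i ∈ S, τ < ‖x i‖ ∧ ‖x i‖ ≤ 2 * τ) ∧
      ∀ K ⊆ S, K.Nonempty → F x K ^ s ≤ 4 * 2 ^ s * τ ^ s * K.card := by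
  classical
  have hs0 : s ≠ 0 := by linarith
  -- Near-extremality and discarding U each cost a factor 2, and the dyadic levels cost 2M, so
  -- anything from 8M upwards would do.
  obtain ⟨n, x₀, hx₀⟩ := hfail (16 * (M + 1))
  have hF : ∀ y : Fin n → X, F y Finset.univ = 0 → ∑ i, ‖y i‖ ^ s = 0 := fun y hy => by
    refine Finset.sum_eq_zero fun i _ => ?_
    rw [le_antisymm (hy ▸ hnorm y i) (norm_nonneg _), Real.zero_rpow hs0]
  have hle : ∀ y : Fin n → X, ∑ i, ‖y i‖ ^ s ≤ n * F y Finset.univ ^ s := fun y => by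
    calc ∑ i, ‖y i‖ ^ s ≤ ∑ i : Fin n, F y Finset.univ ^ s := Finset.sum_le_sum fun i _ =>
          Real.rpow_le_rpow (norm_nonneg _) (hnorm y i) (by linarith)
      _ = _ := by simp
  -- The length n is fixed, so the best constant c is finite (at most n); blocking with labels in
  -- `Fin n` keeps the length.
  let A : Set ℝ := Set.range fun y : Fin n → X => (∑ i, ‖y i‖ ^ s) / F y Finset.univ ^ s
  have hA : BddAbove A := by
    refine ⟨n, ?_⟩
    rintro _ ⟨y, rfl⟩
    exact div_le_of_le_mul₀ (Real.rpow_nonneg (h0 _ _) _) (by positivity) (hle y)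
  set c := sSup A with hc
  have hx₀F : 0 < F x₀ Finset.univ ^ s := by
    rcases (h0 x₀ Finset.univ).eq_or_lt with h | h
    · rw [hF x₀ h.symm, ← h, Real.zero_rpow hs0] at hx₀; simp at hx₀
    · positivity
  have hc16 : 16 * ((M : ℝ) + 1) < c :=
    ((lt_div_iff₀ hx₀F).2 hx₀).trans_le (le_csSup hA ⟨x₀, rfl⟩)
  have hcpos : 0 < c := lt_trans (by positivity) hc16
  have hcle : ∀ y : Fin n → X, ∑ j, ‖y j‖ ^ s ≤ c * F y Finset.univ ^ s := fun y => by
    rcases (h0 y Finset.univ).eq_or_lt with h | h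
    · rw [hF y h.symm]; exact mul_nonneg hcpos.le (Real.rpow_nonneg (h0 _ _) _)
    · exact (div_le_iff₀ (by positivity)).1 (le_csSup hA ⟨y, rfl⟩)
  obtain ⟨_, ⟨x, rfl⟩, hx⟩ := exists_lt_of_lt_csSup (Set.range_nonempty _) (half_lt_self hcpos)
  have hFx : 0 < F x Finset.univ ^ s := by
    rcases (h0 x Finset.univ).eq_or_lt with h | h
    · simp only [hF x h.symm, zero_div] at hx; linarith
    · positivity
  simp only [lt_div_iff₀ hFx] at hx
  set m := ∑ i, ‖x i‖ ^ s with hm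
  -- Remove the sets K on which F is too large. Since x is nearly extremal for c and c also controls
  -- blocks, the removed part carries less than half of m.
  obtain ⟨U, l, hU, hS⟩ :=
    exists_exhaustion fun K : Finset (Fin n) => 4 * ∑ i ∈ K, ‖x i‖ ^ s < F x K ^ s
  have hUm : 2 * ∑ i ∈ U, ‖x i‖ ^ s < m := by
    have h1 : 4 * ∑ i ∈ U, ‖x i‖ ^ s ≤ c * F x U ^ s := by
      refine le_trans ?_ (hblock c hcpos.le hcle x U l)
      rw [← Finset.sum_fiberwise U l, Finset.mul_sum]
      refine Finset.sum_le_sum fun j _ => ?_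
      rcases hU j with h | h
      · rw [h]; simpa using Real.rpow_nonneg (h0 _ _) _
      · exact h.le
    have h2 : F x U ^ s ≤ F x Finset.univ ^ s :=
      Real.rpow_le_rpow (h0 _ _) (hmono _ _ _ (Finset.subset_univ _)) (by linarith)
    nlinarith
  have hUc : m < 2 * ∑ i ∈ Uᶜ, ‖x i‖ ^ s := by
    have := Finset.sum_add_sum_compl U fun i => ‖x i‖ ^ s
    linarith
  -- Otherwise the mass of the complement of U, more than (c/4) F^s, would be at most 2M F^s.
  have hlevel : ∃ τ : ℝ, 0 < τ ∧ M < (Uᶜ.filter fun i => τ < ‖x i‖ ∧ ‖x i‖ ≤ 2 * τ).card := by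
    by_contra! hcon
    have h1 := sum_rpow_le_of_card_level_le hs M (fun i => ‖x i‖) (fun _ => norm_nonneg _) Uᶜ hcon
      (fun i _ => hnorm x i) (h0 _ _)
    nlinarith
  obtain ⟨τ, hτ, hcard⟩ := hlevel
  refine ⟨n, x, _, τ, hτ, hcard, fun i hi => (Finset.mem_filter.1 hi).2, fun K hK hne => ?_⟩
  have h1 := not_lt.1 (hS K (hK.trans (Finset.filter_subset _ _)) hne)
  have h2 : ∑ i ∈ K, ‖x i‖ ^ s ≤ K.card * (2 * τ) ^ s := by
    calc ∑ i ∈ K, ‖x i‖ ^ s ≤ ∑ i ∈ K, (2 * τ) ^ s := Finset.sum_le_sum fun i hi =>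
          Real.rpow_le_rpow (norm_nonneg _) (Finset.mem_filter.1 (hK hi)).2.2 (by linarith)
      _ = _ := by simp
  rw [Real.mul_rpow (by norm_num) hτ.le] at h2
  linarith

/-! ### Contraction principle for Rademacher suprema -/

section Contraction

variable {n : ℕ}

theorem bddAbove_range_signed {Φ : Type*} {b : Fin n → Φ → ℝ} {B : ℝ} (hb : ∀ i φ, |b i φ| ≤ B)
    (ε : Fin n → ℤˣ) : BddAbove (Set.range fun φ => ∑ i, (ε i : ℤ) * b i φ) := by
  refine ⟨∑ _i : Fin n, B, ?_⟩
  rintro _ ⟨φ, rfl⟩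
  refine Finset.sum_le_sum fun i _ => le_trans ?_ (hb i φ)
  rcases Int.units_eq_one_or (ε i) with h | h <;> simp [h, le_abs_self, neg_le_abs]

/-- Pair each ε with its flip at j. For test points φ, ψ in the two suprema, |b_j φ| - |b_j ψ| ≤
|b_j φ - b_j ψ|, and exchanging φ and ψ provides either sign of the difference. -/
theorem sum_iSup_signed_le_of_abs_coord {Φ : Type*} [Nonempty Φ] {b b' : Fin n → Φ → ℝ} {B : ℝ}
    (hb : ∀ i φ, |b i φ| ≤ B) (j : Fin n) (hj : ∀ φ, b' j φ = |b j φ|)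
    (hne : ∀ i ≠ j, b' i = b i) :
    ∑ ε : Fin n → ℤˣ, ⨆ φ, ∑ i, (ε i : ℤ) * b' i φ
      ≤ ∑ ε : Fin n → ℤˣ, ⨆ φ, ∑ i, (ε i : ℤ) * b i φ := by
  classical
  set δ : Fin n → ℤˣ := Function.update 1 j (-1) with hδ
  have hpair : ∀ ε : Fin n → ℤˣ,
      (⨆ φ, ∑ i, (ε i : ℤ) * b' i φ) + (⨆ φ, ∑ i, ((ε * δ) i : ℤ) * b' i φ)
        ≤ (⨆ φ, ∑ i, (ε i : ℤ) * b i φ) + (⨆ φ, ∑ i, ((ε * δ) i : ℤ) * b i φ) := by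
    intro ε
    have hs : ∀ (η : Fin n → ℤˣ) (d : Fin n → Φ → ℝ) φ, ∑ i, (η i : ℤ) * d i φ
        = ((η j : ℤ) : ℝ) * d j φ + ∑ i ∈ Finset.univ.erase j, (η i : ℤ) * d i φ :=
      fun η d φ => (Finset.add_sum_erase _ (fun i => ((η i : ℤ) : ℝ) * d i φ)
        (Finset.mem_univ j)).symm
    have hr' : ∀ φ, ∑ i ∈ Finset.univ.erase j, ((ε i : ℤ) : ℝ) * b' i φ
        = ∑ i ∈ Finset.univ.erase j, ((ε i : ℤ) : ℝ) * b i φ := fun φ =>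
      Finset.sum_congr rfl fun i hi => by rw [hne i (Finset.ne_of_mem_erase hi)]
    have hrδ : ∀ (d : Fin n → Φ → ℝ) φ,
        ∑ i ∈ Finset.univ.erase j, (((ε * δ) i : ℤ) : ℝ) * d i φ
          = ∑ i ∈ Finset.univ.erase j, ((ε i : ℤ) : ℝ) * d i φ := fun d φ =>
      Finset.sum_congr rfl fun i hi => by simp [hδ, Finset.ne_of_mem_erase hi]
    have hδj : ((((ε * δ) j : ℤˣ) : ℤ) : ℝ) = -((ε j : ℤ) : ℝ) := by simp [hδ]
    have h1 := fun φ => le_ciSup (bddAbove_range_signed hb ε) φ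
    have h2 := fun φ => le_ciSup (bddAbove_range_signed hb (ε * δ)) φ
    simp only [hs ε, hs (ε * δ), hr', hrδ, hδj] at h1 h2 ⊢
    set S1 := ⨆ φ, ((ε j : ℤ) : ℝ) * b j φ
      + ∑ i ∈ Finset.univ.erase j, ((ε i : ℤ) : ℝ) * b i φ
    set S2 := ⨆ φ, -((ε j : ℤ) : ℝ) * b j φ
      + ∑ i ∈ Finset.univ.erase j, ((ε i : ℤ) : ℝ) * b i φ
    rw [← le_sub_iff_add_le]
    refine ciSup_le fun φ => ?_
    rw [le_sub_iff_add_le, ← le_sub_iff_add_le']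
    refine ciSup_le fun ψ => ?_
    rw [le_sub_iff_add_le']
    have e1 := h1 φ
    have e2 := h1 ψ
    have e3 := h2 φ
    have e4 := h2 ψ
    rw [hj, hj]
    rcases Int.units_eq_one_or (ε j) with h | h <;> simp only [h] at e1 e2 e3 e4 ⊢ <;>
      push_cast at e1 e2 e3 e4 ⊢ <;>
      rcases abs_cases (b j φ) with ⟨h3, _⟩ | ⟨h3, _⟩ <;>
      rcases abs_cases (b j ψ) with ⟨h4, _⟩ | ⟨h4, _⟩ <;> rw [h3, h4] <;> linarith
  have := Finset.sum_le_sum fun ε (_ : ε ∈ (Finset.univ : Finset (Fin n → ℤˣ))) => hpair ε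
  rw [Finset.sum_add_distrib, Finset.sum_add_distrib,
    sum_signs_mul δ fun ε => ⨆ φ, ∑ i, (ε i : ℤ) * b' i φ,
    sum_signs_mul δ fun ε => ⨆ φ, ∑ i, (ε i : ℤ) * b i φ] at this
  linarith

/-- The contraction principle for the absolute value. -/
theorem sum_iSup_signed_abs_le {Φ : Type*} [Nonempty Φ] {b : Fin n → Φ → ℝ} {B : ℝ}
    (hb : ∀ i φ, |b i φ| ≤ B) :
    ∑ ε : Fin n → ℤˣ, ⨆ φ, ∑ i, (ε i : ℤ) * |b i φ|
      ≤ ∑ ε : Fin n → ℤˣ, ⨆ φ, ∑ i, (ε i : ℤ) * b i φ := by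
  classical
  have key : ∀ T : Finset (Fin n),
      ∑ ε : Fin n → ℤˣ, ⨆ φ, ∑ i, (ε i : ℤ) * (if i ∈ T then |b i φ| else b i φ)
        ≤ ∑ ε : Fin n → ℤˣ, ⨆ φ, ∑ i, (ε i : ℤ) * b i φ := by
    intro T
    induction T using Finset.induction_on with
    | empty => simp
    | insert j T hjT ih =>
      refine le_trans ?_ ih
      refine sum_iSup_signed_le_of_abs_coord (B := B)
        (b := fun i φ => if i ∈ T then |b i φ| else b i φ)
        (b' := fun i φ => if i ∈ insert j T then |b i φ| else b i φ) (fun i φ => ?_) j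
        (fun φ => ?_) fun i hi => ?_
      · split_ifs <;> simp [hb]
      · simp [hjT]
      · funext φ
        simp [hi]
  simpa using key Finset.univ

end Contraction

/-! ### Selecting half of a family -/

section Selection

variable {X : Type*} [NormedAddCommGroup X] {n : ℕ}

theorem sum_abs_le_signMax (x : Fin n → X) (K : Finset (Fin n)) (f : X →+ ℝ) {B : ℝ}
    (hB : 0 ≤ B) (hf : ∀ v, f v ≤ B * ‖v‖) : ∑ i ∈ K, |f (x i)| ≤ B * signMax x K := by
  have h : ∑ i ∈ K, |f (x i)| = f (signedSum x K fun i => if 0 ≤ f (x i) then 1 else -1) := by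
    rw [signedSum, map_sum]
    refine Finset.sum_congr rfl fun i _ => ?_
    split_ifs with h
    · simp [abs_of_nonneg h]
    · simp [abs_of_neg (not_le.1 h)]
  rw [h]
  exact (hf _).trans (mul_le_mul_of_nonneg_left (le_signMax _ _ _) hB)

theorem sum_signs_sq (K : Finset (Fin n)) (a : Fin n → ℝ) :
    ∑ ε : Fin n → ℤˣ, (∑ i ∈ K, ((ε i : ℤ) : ℝ) * a i) ^ 2 = 2 ^ n * ∑ i ∈ K, a i ^ 2 := by
  classical
  induction K using Finset.induction_on with
  | empty => simp
  | insert j K hj ih =>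
    set δ : Fin n → ℤˣ := Function.update 1 j (-1) with hδ
    have hpair : ∀ ε : Fin n → ℤˣ, (∑ i ∈ insert j K, ((ε i : ℤ) : ℝ) * a i) ^ 2
        + (∑ i ∈ insert j K, (((ε * δ) i : ℤ) : ℝ) * a i) ^ 2
        = 2 * (∑ i ∈ K, ((ε i : ℤ) : ℝ) * a i) ^ 2 + 2 * a j ^ 2 := by
      intro ε
      rw [Finset.sum_insert hj, Finset.sum_insert hj]
      have h1 : ∑ i ∈ K, (((ε * δ) i : ℤ) : ℝ) * a i = ∑ i ∈ K, ((ε i : ℤ) : ℝ) * a i :=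
        Finset.sum_congr rfl fun i hi => by
          simp [hδ, ne_of_mem_of_not_mem hi hj]
      have h2 : ((((ε * δ) j : ℤˣ) : ℤ) : ℝ) = -((ε j : ℤ) : ℝ) := by simp [hδ]
      rw [h1, h2]
      rcases Int.units_eq_one_or (ε j) with h | h <;> rw [h] <;> push_cast <;> ring
    have := Finset.sum_congr rfl fun ε (_ : ε ∈ (Finset.univ : Finset (Fin n → ℤˣ))) => hpair ε
    rw [Finset.sum_add_distrib,
      sum_signs_mul δ fun ε => (∑ i ∈ insert j K, ((ε i : ℤ) : ℝ) * a i) ^ 2,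
      Finset.sum_add_distrib, ← Finset.mul_sum, ih, Finset.sum_const, Finset.card_univ,
      card_signs, nsmul_eq_mul] at this
    rw [Finset.sum_insert hj]
    push_cast at this
    linarith

variable [NormedSpace ℝ X]

theorem map_signedSum (φ : X →L[ℝ] ℝ) (x : Fin n → X) (K : Finset (Fin n)) (ε : Fin n → ℤˣ) :
    φ (signedSum x K ε) = ∑ i ∈ K, ((ε i : ℤ) : ℝ) * φ (x i) := by
  simp [signedSum, map_sum, map_zsmul]

theorem exists_functional_signMax (x : Fin n → X) (K : Finset (Fin n)) :
    ∃ φ : X →L[ℝ] ℝ, ‖φ‖ ≤ 1 ∧ signMax x K ≤ ∑ i ∈ K, |φ (x i)| := by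
  obtain ⟨θ, hθ⟩ := exists_eq_signMax x K
  obtain ⟨φ, hφ1, hφ⟩ := exists_dual_vector'' ℝ (signedSum x K θ)
  refine ⟨φ, hφ1, ?_⟩
  rw [← hθ]
  calc ‖signedSum x K θ‖ = φ (signedSum x K θ) := by rw [hφ]; rfl
    _ = ∑ i ∈ K, ((θ i : ℤ) : ℝ) * φ (x i) := map_signedSum φ x K θ
    _ ≤ _ := Finset.sum_le_sum fun i _ => by
      rcases Int.units_eq_one_or (θ i) with h | h <;> simp [h, le_abs_self, neg_le_abs]

/-- By orthogonality of the signs, ∑ φ(x_i)² is at most the squared Rademacher average for ‖φ‖ ≤ 1;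
Cauchy–Schwarz does the rest. -/
theorem signMax_le_sqrt_card_mul_radAvg (x : Fin n → X) (K : Finset (Fin n)) :
    signMax x K ≤ √K.card * radAvg x K := by
  obtain ⟨φ, hφ1, hφ⟩ := exists_functional_signMax x K
  refine hφ.trans ?_
  have h1 : ∑ i ∈ K, φ (x i) ^ 2 ≤ radAvg x K ^ 2 := by
    have h2 : ∑ ε : Fin n → ℤˣ, (∑ i ∈ K, ((ε i : ℤ) : ℝ) * φ (x i)) ^ 2
        ≤ ∑ ε, ‖signedSum x K ε‖ ^ 2 := by
      refine Finset.sum_le_sum fun ε _ => ?_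
      rw [← map_signedSum, ← sq_abs]
      have := φ.le_of_opNorm_le hφ1 (signedSum x K ε)
      rw [one_mul, Real.norm_eq_abs] at this
      gcongr
    rw [sum_signs_sq] at h2
    rw [radAvg_sq, ← div_eq_inv_mul, le_div_iff₀ (by positivity)]
    linarith
  have h3 := sq_sum_le_card_mul_sum_sq (s := K) (f := fun i => |φ (x i)|)
  simp only [sq_abs] at h3
  refine abs_le_of_sq_le_sq' ?_ (mul_nonneg (Real.sqrt_nonneg _) (radAvg_nonneg x K)) |>.2
  rw [mul_pow, Real.sq_sqrt (by positivity)]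
  exact h3.trans (by gcongr)

/-- Half of a family can be selected so that the largest signed sum is halved, up to the
Rademacher average. -/
theorem exists_half_signMax_le (x : Fin n → X) {K : Finset (Fin n)} {m : ℕ}
    (hK : K.card = 2 * m) :
    ∃ J ⊆ K, J.card = m ∧ signMax x J ≤ signMax x K / 2 + radAvg x K := by
  classical
  let Φ := {φ : X →L[ℝ] ℝ // ‖φ‖ ≤ 1}
  let φ₀ : Φ := ⟨0, by simp⟩
  have : Nonempty Φ := ⟨φ₀⟩
  let b : Fin n → Φ → ℝ := fun i φ => if i ∈ K then φ.1 (x i) else 0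
  have hb : ∀ i φ, |b i φ| ≤ ∑ i, ‖x i‖ := by
    intro i φ
    have h1 : ‖x i‖ ≤ ∑ i, ‖x i‖ :=
      Finset.single_le_sum (f := fun i => ‖x i‖) (fun _ _ => norm_nonneg _) (Finset.mem_univ i)
    by_cases hi : i ∈ K
    · have := φ.1.le_of_opNorm_le φ.2 (x i)
      rw [one_mul, Real.norm_eq_abs] at this
      simpa [b, hi] using this.trans h1
    · simpa [b, hi] using (norm_nonneg _).trans h1
  set A : (Fin n → ℤˣ) → ℝ := fun ε => ⨆ φ, ∑ i, (ε i : ℤ) * |b i φ| with hA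
  have hAle : ∀ ε (φ : Φ), ∑ i ∈ K, ((ε i : ℤ) : ℝ) * |φ.1 (x i)| ≤ A ε := by
    intro ε φ
    refine le_trans (le_of_eq ?_) (le_ciSup (bddAbove_range_signed (b := fun i φ => |b i φ|)
      (fun i φ => (abs_abs (b i φ)).trans_le (hb i φ)) ε) φ)
    rw [← Finset.sum_subset (Finset.subset_univ K)]
    · exact Finset.sum_congr rfl fun i hi => by simp [b, hi]
    · intro i _ hi
      simp [b, hi]
  have hA0 : ∀ ε, 0 ≤ A ε := fun ε => by simpa [φ₀] using hAle ε φ₀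
  have hsum : ∑ ε, A ε ≤ 2 ^ n * radAvg x K := by
    refine (sum_iSup_signed_abs_le hb).trans (le_trans ?_ (sum_norm_signedSum_le x K))
    refine Finset.sum_le_sum fun ε _ => ciSup_le fun φ => ?_
    have h1 : ∑ i, ((ε i : ℤ) : ℝ) * b i φ = φ.1 (signedSum x K ε) := by
      rw [map_signedSum, ← Finset.sum_subset (Finset.subset_univ K)]
      · exact Finset.sum_congr rfl fun i hi => by simp [b, hi]
      · intro i _ hi
        simp [b, hi]
    rw [h1]
    have := φ.1.le_of_opNorm_le φ.2 (signedSum x K ε)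
    rw [one_mul] at this
    exact (le_abs_self _).trans this
  -- By contraction the mean of A is at most the Rademacher average, so some ε is good together with
  -- -ε. Both sign classes of ε then carry about half of ∑|φ(x_i)|, uniformly in φ.
  obtain ⟨ε, -, hε⟩ : ∃ ε ∈ (Finset.univ : Finset (Fin n → ℤˣ)),
      A ε + A (ε * -1) ≤ 2 * radAvg x K := by
    refine Finset.exists_le_of_sum_le Finset.univ_nonempty ?_
    rw [Finset.sum_add_distrib, sum_signs_mul (-1) A, Finset.sum_const, Finset.card_univ,
      card_signs, nsmul_eq_mul]
    push_cast
    linarith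
  have hside : ∀ u : ℤˣ,
      signMax x (K.filter fun i => ε i = u) ≤ signMax x K / 2 + radAvg x K := by
    intro u
    obtain ⟨φ, hφ1, hφ⟩ := exists_functional_signMax x (K.filter fun i => ε i = u)
    have h1 : ∑ i ∈ K.filter fun i => ε i = u, |φ (x i)|
        = (∑ i ∈ K, |φ (x i)|) / 2 + (∑ i ∈ K, (((ε i * u : ℤˣ) : ℤ) : ℝ) * |φ (x i)|) / 2 := by
      rw [← add_div, ← Finset.sum_add_distrib, Finset.sum_div, Finset.sum_filter]
      refine Finset.sum_congr rfl fun i _ => ?_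
      rcases Int.units_eq_one_or (ε i) with h | h <;> rcases Int.units_eq_one_or u with h' | h' <;>
        simp [h, h']
    have h2 : ∑ i ∈ K, |φ (x i)| ≤ 1 * signMax x K :=
      sum_abs_le_signMax x K (φ : X →ₗ[ℝ] ℝ).toAddMonoidHom zero_le_one fun v =>
        (le_abs_self _).trans (φ.le_of_opNorm_le hφ1 v)
    have h3 : ∑ i ∈ K, (((ε i * u : ℤˣ) : ℤ) : ℝ) * |φ (x i)| ≤ 2 * radAvg x K := by
      rcases Int.units_eq_one_or u with rfl | rfl
      · have := hAle ε ⟨φ, hφ1⟩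
        simp only [mul_one]
        linarith [hA0 (ε * -1)]
      · have := hAle (ε * -1) ⟨φ, hφ1⟩
        simp only [Pi.mul_apply, Pi.neg_apply, Pi.one_apply] at this
        linarith [hA0 ε]
    linarith
  have hcard : (K.filter fun i => ε i = 1).card + (K.filter fun i => ε i = -1).card
      = 2 * m := by
    rw [← hK, ← Finset.card_filter_add_card_filter_not (s := K) (fun i => ε i = 1)]
    congr 2
    refine Finset.filter_congr fun i _ => ?_
    rcases Int.units_eq_one_or (ε i) with h | h <;> simp [h]
  have hbig : ∃ u : ℤˣ, m ≤ (K.filter fun i => ε i = u).card := by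
    by_contra! hcon
    have h1 := hcon 1
    have h2 := hcon (-1)
    omega
  obtain ⟨u, hu⟩ := hbig
  obtain ⟨J, hJ, hJm⟩ := Finset.exists_subset_card_eq hu
  exact ⟨J, hJ.trans (Finset.filter_subset _ _), hJm, (signMax_mono x hJ).trans (hside u)⟩

end Selection

/-! ### From failure of cotype to small maxima over signs -/

section Cotype

variable {X : Type*} [NormedAddCommGroup X]

theorem exists_radAvg_lt_of_not_hasCotype {s : ℝ} (hs : 0 < s) (h : ¬ HasCotype X s) (C : ℝ) :
    ∃ (n : ℕ) (x : Fin n → X), C * radAvg x Finset.univ ^ s < ∑ i, ‖x i‖ ^ s := by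
  unfold HasCotype at h
  push Not at h
  obtain ⟨n, x, hx⟩ := h (max C 0 ^ (1 / s))
  refine ⟨n, x, ?_⟩
  change max C 0 ^ (1 / s) * radAvg x Finset.univ < _ at hx
  have h0 := radAvg_nonneg x Finset.univ
  have h1 := Real.rpow_lt_rpow (by positivity) hx hs
  rw [Real.mul_rpow (by positivity) h0, ← Real.rpow_mul (by positivity),
    ← Real.rpow_mul (Finset.sum_nonneg fun _ _ => by positivity), one_div,
    inv_mul_cancel₀ hs.ne', Real.rpow_one, Real.rpow_one] at h1
  exact (mul_le_mul_of_nonneg_right (le_max_left _ _) (by positivity)).trans_lt h1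

theorem le_of_rpow_le_mul {a b τ k s : ℝ} (hs : 0 < s) (ha : 0 ≤ a) (hb : 0 ≤ b) (hτ : 0 ≤ τ)
    (hk : 0 ≤ k) (h : a ^ s ≤ b * τ ^ s * k) : a ≤ b ^ (1 / s) * τ * k ^ (1 / s) := by
  have h1 := Real.rpow_le_rpow (by positivity) h (by positivity : 0 ≤ 1 / s)
  rw [Real.mul_rpow (by positivity) hk, Real.mul_rpow hb (by positivity), ← Real.rpow_mul ha,
    ← Real.rpow_mul hτ, mul_one_div_cancel hs.ne', Real.rpow_one, Real.rpow_one] at h1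
  exact h1

theorem two_pow_rpow (N : ℕ) (a : ℝ) : ((2 : ℝ) ^ N) ^ a = 2 ^ (N * a) := by
  rw [← Real.rpow_natCast, ← Real.rpow_mul (by norm_num)]

variable [NormedSpace ℝ X]

/-- Iterated halving of a family whose subfamilies have small Rademacher averages. -/
theorem exists_subset_signMax_le {n N : ℕ} (x : Fin n → X) {S : Finset (Fin n)}
    (hS : S.card = 2 ^ N) {s D : ℝ} (hs : 2 ≤ s) (hD : 0 ≤ D)
    (h : ∀ K ⊆ S, K.Nonempty → radAvg x K ≤ D * (K.card : ℝ) ^ (1 / s)) (k p : ℕ)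
    (hkp : p + k = N) :
    ∃ J ⊆ S, J.card = 2 ^ p ∧
      signMax x J ≤ signMax x S / 2 ^ k + 6 * D * ((2 : ℝ) ^ p) ^ (1 / s) := by
  induction k generalizing p with
  | zero =>
    refine ⟨S, subset_rfl, by rw [hS, ← hkp, add_zero], ?_⟩
    have : 0 ≤ 6 * D * ((2 : ℝ) ^ p) ^ (1 / s) := by positivity
    simpa using this
  | succ k ih =>
    obtain ⟨J, hJS, hJ, hle⟩ := ih (p + 1) (by omega)
    obtain ⟨J', hJ', hc, hle'⟩ := exists_half_signMax_le x (K := J) (m := 2 ^ p)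
      (by rw [hJ, pow_succ]; ring)
    refine ⟨J', hJ'.trans hJS, hc, hle'.trans ?_⟩
    have h1 := h J hJS (Finset.card_pos.1 (by rw [hJ]; positivity))
    rw [hJ] at h1
    push_cast at h1
    -- This is where the constant 6 comes from: (6/2 + 1) · 3/2 = 6.
    have h2 : ((2 : ℝ) ^ (p + 1)) ^ (1 / s) ≤ 3 / 2 * ((2 : ℝ) ^ p) ^ (1 / s) := by
      rw [pow_succ, Real.mul_rpow (by positivity) (by norm_num), mul_comm]
      refine mul_le_mul_of_nonneg_right ?_ (by positivity)
      calc (2 : ℝ) ^ (1 / s) ≤ 2 ^ (1 / 2 : ℝ) :=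
            Real.rpow_le_rpow_of_exponent_le (by norm_num)
              (one_div_le_one_div_of_le (by norm_num) hs)
        _ = √2 := (Real.sqrt_eq_rpow 2).symm
        _ ≤ 3 / 2 := Real.sqrt_le_iff.2 (by norm_num)
    have h3 : signMax x S / 2 ^ (k + 1) = signMax x S / 2 ^ k / 2 := by
      rw [pow_succ, div_div]
    rw [h3]
    nlinarith [mul_le_mul_of_nonneg_left h2 hD]

theorem exists_signMax_le_of_not_hasCotype {s : ℝ} (hs : 2 < s) (h : ¬ HasCotype X s) :
    ∃ C : ℝ, 0 ≤ C ∧ ∀ M : ℕ, ∃ (n : ℕ) (x : Fin n → X) (J : Finset (Fin n)) (τ : ℝ), 0 < τ ∧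
      J.card = 2 ^ M ∧ (∀ i ∈ J, τ < ‖x i‖) ∧
      signMax x J ≤ C * τ * ((2 : ℝ) ^ M) ^ (1 / s) := by
  have hs0 : 0 < s := by linarith
  set D : ℝ := (4 * 2 ^ s) ^ (1 / s) with hD
  have hD0 : 0 ≤ D := by positivity
  refine ⟨7 * D, by positivity, fun M => ?_⟩
  have hgap : 0 < 1 / 2 - 1 / s := by
    have := one_div_lt_one_div_of_lt (by norm_num : (0 : ℝ) < 2) hs
    linarith
  -- So many halvings absorb the crude initial bound of order 2^(N(1/2 + 1/s)); this is possible
  -- because s > 2 makes 1/2 + 1/s < 1.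
  obtain ⟨k, hk⟩ := exists_nat_ge (M / (1 / 2 - 1 / s))
  set N := M + k with hN
  obtain ⟨n, x, S, τ, hτ, hcard, hnorm, hher⟩ := exists_hereditary_family (X := X)
    (s := s) (by linarith) (fun x K => radAvg x K) (fun x K => radAvg_nonneg x K)
    (fun x K L => radAvg_mono x) (fun x i => norm_le_radAvg x i)
    (fun c hc hy x U l => radAvg_blocks x hs.le hc hy U l)
    (exists_radAvg_lt_of_not_hasCotype hs0 h) (2 ^ N)
  obtain ⟨S', hS', hS'c⟩ := Finset.exists_subset_card_eq hcard.le
  have hher' : ∀ K ⊆ S', K.Nonempty → radAvg x K ≤ (D * τ) * (K.card : ℝ) ^ (1 / s) :=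
    fun K hK hne => le_of_rpow_le_mul hs0 (radAvg_nonneg x K) (by positivity) hτ.le
      (by positivity) (hher K (hK.trans hS') hne)
  obtain ⟨J, hJ, hJc, hle⟩ := exists_subset_signMax_le x hS'c hs.le (by positivity) hher' k M hN.symm
  refine ⟨n, x, J, τ, hτ, hJc, fun i hi => (hnorm i (hS' (hJ hi))).1, hle.trans ?_⟩
  have h1 : signMax x S' ≤ √(2 ^ N) * ((D * τ) * ((2 : ℝ) ^ N) ^ (1 / s)) := by
    refine (signMax_le_sqrt_card_mul_radAvg x S').trans ?_
    have := hher' S' subset_rfl (Finset.card_pos.1 (by rw [hS'c]; positivity))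
    rw [hS'c] at this ⊢
    push_cast at this ⊢
    gcongr
  have h2 : √(2 ^ N) * ((2 : ℝ) ^ N) ^ (1 / s) ≤ 2 ^ k := by
    rw [Real.sqrt_eq_rpow, two_pow_rpow, two_pow_rpow, ← Real.rpow_add (by norm_num),
      ← Real.rpow_natCast 2 k]
    refine Real.rpow_le_rpow_of_exponent_le (by norm_num) ?_
    rw [div_le_iff₀ hgap] at hk
    rw [hN]
    push_cast
    have : 0 ≤ (M : ℝ) * (1 / 2 - 1 / s) := by positivity
    nlinarith
  have h3 : signMax x S' / 2 ^ k ≤ D * τ := by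
    rw [div_le_iff₀ (by positivity)]
    refine h1.trans ?_
    have : 0 ≤ D * τ := by positivity
    nlinarith [mul_le_mul_of_nonneg_left h2 this]
  have h4 : (1 : ℝ) ≤ ((2 : ℝ) ^ M) ^ (1 / s) :=
    Real.one_le_rpow (one_le_pow₀ (by norm_num)) (by positivity)
  nlinarith [mul_le_mul_of_nonneg_left h4 (by positivity : 0 ≤ D * τ)]

/-- A space without cotype `s > 2` is not `(t, 1)`-summing for `t < s`. -/
theorem exists_signMax_lt_of_not_hasCotype {s t : ℝ} (hs : 2 < s) (h : ¬ HasCotype X s)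
    (ht : 0 < t) (hts : t < s) (C : ℝ) :
    ∃ (n : ℕ) (x : Fin n → X), C * signMax x Finset.univ ^ t < ∑ i, ‖x i‖ ^ t := by
  classical
  have hs0 : 0 < s := by linarith
  obtain ⟨D, hD, hM⟩ := exists_signMax_le_of_not_hasCotype hs h
  have ha : 0 < 1 - t / s := by rw [sub_pos, div_lt_one hs0]; exact hts
  -- The sum of t-th powers grows like 2^M, the t-th power of the maximum only like 2^(Mt/s).
  obtain ⟨M, hMC⟩ := pow_unbounded_of_one_lt (max C 0 * D ^ t)
    (Real.one_lt_rpow (by norm_num : (1 : ℝ) < 2) ha)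
  obtain ⟨n, x, J, τ, hτ, hJ, hnorm, hle⟩ := hM M
  refine ⟨n, fun i => if i ∈ J then x i else 0, ?_⟩
  have h1 : signMax (fun i => if i ∈ J then x i else 0) Finset.univ = signMax x J := by
    unfold signMax signedSum
    congr 1
    funext ε
    congr 1
    rw [← Finset.sum_subset (Finset.subset_univ J)]
    · exact Finset.sum_congr rfl fun i hi => by simp [hi]
    · intro i _ hi
      simp [hi]
  have h2 : (2 : ℝ) ^ M * τ ^ t ≤ ∑ i, ‖(if i ∈ J then x i else 0 : X)‖ ^ t := by
    calc (2 : ℝ) ^ M * τ ^ t = ∑ i ∈ J, τ ^ t := by simp [hJ]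
      _ ≤ ∑ i ∈ J, ‖(if i ∈ J then x i else 0 : X)‖ ^ t := Finset.sum_le_sum fun i hi => by
          rw [if_pos hi]
          exact Real.rpow_le_rpow hτ.le (hnorm i hi).le ht.le
      _ ≤ _ := Finset.sum_le_sum_of_subset_of_nonneg (Finset.subset_univ J) fun _ _ _ => by
          positivity
  have h3 : signMax x J ^ t ≤ D ^ t * τ ^ t * ((2 : ℝ) ^ M) ^ (t / s) := by
    refine (Real.rpow_le_rpow (signMax_nonneg _ _) hle ht.le).trans (le_of_eq ?_)
    rw [Real.mul_rpow (by positivity) (by positivity), Real.mul_rpow hD hτ.le,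
      ← Real.rpow_mul (by positivity)]
    congr 2
    ring
  have h4 : (2 : ℝ) ^ M = ((2 : ℝ) ^ (1 - t / s)) ^ M * ((2 : ℝ) ^ M) ^ (t / s) := by
    rw [two_pow_rpow, ← Real.rpow_natCast (_ ^ (1 - t / s)), ← Real.rpow_mul (by norm_num),
      ← Real.rpow_add (by norm_num), ← Real.rpow_natCast]
    congr 1
    ring
  rw [h1]
  refine lt_of_lt_of_le ?_ h2
  calc C * signMax x J ^ t ≤ max C 0 * (D ^ t * τ ^ t * ((2 : ℝ) ^ M) ^ (t / s)) :=
        mul_le_mul (le_max_left _ _) h3 (Real.rpow_nonneg (signMax_nonneg _ _) _)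
          (le_max_right _ _)
    _ = max C 0 * D ^ t * (((2 : ℝ) ^ M) ^ (t / s) * τ ^ t) := by ring
    _ < ((2 : ℝ) ^ (1 - t / s)) ^ M * (((2 : ℝ) ^ M) ^ (t / s) * τ ^ t) := by gcongr
    _ = (2 : ℝ) ^ M * τ ^ t := by rw [← mul_assoc, ← h4]

end Cotype

/-! ### Weak r-norms of hereditary families -/

section WeakNorm

/-- The minimum over k elements is at most the mean, hence at most C k^(1/t-1), and its r-th power
is at most C^r k^(γ-1). Removing minima one by one leaves a sum of these bounds, of order k^γ/γ. -/
theorem sum_rpow_le_of_hereditary {ι : Type*} [DecidableEq ι] {a : ι → ℝ} (ha : ∀ i, 0 ≤ a i)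
    {C t r : ℝ} (hC : 0 ≤ C) (ht : 1 ≤ t) (hr : 0 < r) (hγ : 0 < 1 - r * (1 - 1 / t))
    (S : Finset ι) (h : ∀ K ⊆ S, ∑ i ∈ K, a i ≤ C * (K.card : ℝ) ^ (1 / t)) :
    ∑ i ∈ S, a i ^ r
      ≤ C ^ r / (1 - r * (1 - 1 / t)) * (S.card : ℝ) ^ (1 - r * (1 - 1 / t)) := by
  set γ := 1 - r * (1 - 1 / t) with hγd
  have hγ1 : γ ≤ 1 := by
    have : 0 ≤ 1 - 1 / t := by
      rw [sub_nonneg, div_le_one (by linarith)]; exact ht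
    nlinarith
  induction S using Finset.strongInduction with
  | H S ih =>
  rcases S.eq_empty_or_nonempty with rfl | hne
  · simp [hγ.ne']
  obtain ⟨i, hi, hmin⟩ := Finset.exists_min_image S a hne
  set k : ℝ := (S.card : ℝ) with hk
  have hk1 : 1 ≤ k := by
    rw [hk, Nat.one_le_cast]; exact Finset.card_pos.2 hne
  have hk0 : 0 < k := by linarith
  have h1 : a i ≤ C * k ^ (1 / t - 1) := by
    have h2 : k * a i ≤ ∑ j ∈ S, a j := by
      simpa using Finset.card_nsmul_le_sum S a (a i) hmin
    have h3 := h2.trans (h S subset_rfl)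
    rw [Real.rpow_sub_one hk0.ne', ← mul_div_assoc, le_div_iff₀ hk0]
    linarith
  have h2 : a i ^ r ≤ C ^ r * k ^ (γ - 1) := by
    refine (Real.rpow_le_rpow (ha i) h1 hr.le).trans (le_of_eq ?_)
    rw [Real.mul_rpow hC (by positivity), ← Real.rpow_mul hk0.le]
    congr 2
    rw [hγd]; ring
  have h3 := ih (S.erase i) (Finset.erase_ssubset hi)
    fun K hK => h K (hK.trans (Finset.erase_subset _ _))
  have h4 : ((S.erase i).card : ℝ) = k - 1 := by
    rw [Finset.card_erase_of_mem hi, Nat.cast_sub (Finset.card_pos.2 hne)]; simp [hk]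
  rw [h4] at h3
  -- Bernoulli's inequality for exponents in (0, 1] makes the sum telescope.
  have h5 : (k - 1) ^ γ ≤ k ^ γ - γ * k ^ (γ - 1) := by
    have hb := rpow_one_add_le_one_add_mul_self (s := -(1 / k)) (p := γ)
      (by rw [neg_le_neg_iff, div_le_one hk0]; exact hk1) hγ.le hγ1
    have e : k - 1 = k * (1 + -(1 / k)) := by field_simp; ring
    have hnn : 0 ≤ 1 + -(1 / k) := by
      have : 1 / k ≤ 1 := by rw [div_le_one hk0]; exact hk1
      linarith
    rw [e, Real.mul_rpow hk0.le hnn]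
    refine (mul_le_mul_of_nonneg_left hb (by positivity)).trans (le_of_eq ?_)
    rw [Real.rpow_sub_one hk0.ne']
    field_simp
    ring
  rw [← Finset.add_sum_erase S _ hi]
  have h6 : C ^ r / γ * (k - 1) ^ γ ≤ C ^ r / γ * (k ^ γ - γ * k ^ (γ - 1)) :=
    mul_le_mul_of_nonneg_left h5 (by positivity)
  have h7 : C ^ r / γ * (k ^ γ - γ * k ^ (γ - 1)) = C ^ r / γ * k ^ γ - C ^ r * k ^ (γ - 1) := by
    field_simp
  linarith

variable {𝕜 X : Type*} [RCLike 𝕜] [NormedAddCommGroup X] [NormedSpace 𝕜 X]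

/-- Real and imaginary parts are each handled by one choice of real signs, whence the factor 2. -/
theorem sum_norm_le_signMax {n : ℕ} (φ : X →L[𝕜] 𝕜) (x : Fin n → X) (K : Finset (Fin n)) :
    ∑ i ∈ K, ‖φ (x i)‖ ≤ 2 * ‖φ‖ * signMax x K := by
  have h1 := sum_abs_le_signMax x K ((RCLike.re : 𝕜 →+ ℝ).comp (φ : X →ₗ[𝕜] 𝕜).toAddMonoidHom)
    (norm_nonneg φ) fun v => (RCLike.re_le_norm _).trans (φ.le_opNorm v)
  have h2 := sum_abs_le_signMax x K ((RCLike.im : 𝕜 →+ ℝ).comp (φ : X →ₗ[𝕜] 𝕜).toAddMonoidHom)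
    (norm_nonneg φ) fun v => (RCLike.im_le_norm _).trans (φ.le_opNorm v)
  have h3 : ∑ i ∈ K, ‖φ (x i)‖
      ≤ ∑ i ∈ K, (|RCLike.re (φ (x i))| + |RCLike.im (φ (x i))|) :=
    Finset.sum_le_sum fun i _ => by
      refine abs_le_of_sq_le_sq' ?_ (by positivity) |>.2
      rw [RCLike.norm_sq_eq_def, add_sq, sq_abs, sq_abs]
      nlinarith [mul_nonneg (abs_nonneg (RCLike.re (φ (x i)))) (abs_nonneg (RCLike.im (φ (x i))))]
  rw [Finset.sum_add_distrib] at h3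
  refine h3.trans ?_
  refine (add_le_add h1 h2).trans (le_of_eq ?_)
  ring

/-- In a space without cotype `s > 2` there are, for `r < 2`, arbitrarily long families of vectors
of norm at least `1` whose weak `r`-norms grow slower than `|S| ^ (1 / r - 1 / 2)`. -/
theorem exists_weak_norm_le (𝕜 : Type*) {X : Type*} [RCLike 𝕜] [NormedAddCommGroup X]
    [NormedSpace 𝕜 X] {s r : ℝ} (hs : 2 < s) (h : ¬ HasCotype X s) (hr : 0 < r) (hr2 : r < 2) :
    ∃ C γ : ℝ, 0 ≤ C ∧ γ < 1 - r / 2 ∧ ∀ M : ℕ, ∃ (n : ℕ) (x : Fin n → X) (S : Finset (Fin n)),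
      S.card = M ∧ (∀ i ∈ S, 1 ≤ ‖x i‖) ∧
      ∀ φ : X →L[𝕜] 𝕜, ∑ i ∈ S, ‖φ (x i)‖ ^ r ≤ C * ‖φ‖ ^ r * (M : ℝ) ^ γ := by
  classical
  -- The selection argument uses real functionals; cotype and signed sums do not depend on the
  -- scalars.
  let _ : NormedSpace ℝ X := NormedSpace.restrictScalars ℝ 𝕜 X
  -- Here 2 < t < s, with t close enough to 2 for r(1 - 1/t) < 1; t > 2 is what gives γ < 1 - r/2.
  set t := 2 + min (s - 2) (2 - r) / 2 with ht
  have hδ : 0 < min (s - 2) (2 - r) := lt_min (by linarith) (by linarith)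
  have hδ1 := min_le_left (s - 2) (2 - r)
  have hδ2 := min_le_right (s - 2) (2 - r)
  have ht2 : 2 < t := by linarith
  have hts : t < s := by linarith
  have ht0 : 0 < t := by linarith
  have hγ : 0 < 1 - r * (1 - 1 / t) := by
    have h1 : r * (t - 1) < t := by
      rcases le_total r 1 with h | h <;> nlinarith
    have h2 : r * (1 - 1 / t) = r * (t - 1) / t := by field_simp
    rw [h2, sub_pos, div_lt_one ht0]
    exact h1
  set γ := 1 - r * (1 - 1 / t) with hγd
  set D : ℝ := (4 * 2 ^ t) ^ (1 / t) with hD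
  refine ⟨(2 * D) ^ r / γ, γ, by positivity, ?_, fun M => ?_⟩
  · have : 1 / t < 1 / 2 := one_div_lt_one_div_of_lt (by norm_num) ht2
    rw [hγd]
    nlinarith
  obtain ⟨n, x, S', τ, hτ, hcard, hnorm, hher⟩ := exists_hereditary_family (X := X)
    (s := t) (by linarith) (fun x K => signMax x K) (fun x K => signMax_nonneg x K)
    (fun x K L => signMax_mono x) (fun x i => norm_le_signMax x i)
    (fun c hc hy x U l => signMax_blocks x ht0.le hc hy U l)
    (exists_signMax_lt_of_not_hasCotype hs h ht0 hts) M
  obtain ⟨S, hS, hSc⟩ := Finset.exists_subset_card_eq hcard.le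
  refine ⟨n, fun i => ((τ⁻¹ : ℝ) : 𝕜) • x i, S, hSc, fun i hi => ?_, fun φ => ?_⟩
  · rw [norm_smul, RCLike.norm_ofReal, abs_of_pos (by positivity), inv_mul_eq_div, le_div_iff₀ hτ,
      one_mul]
    exact (hnorm i (hS hi)).1.le
  have h1 : ∀ i, ‖φ (((τ⁻¹ : ℝ) : 𝕜) • x i)‖ = τ⁻¹ * ‖φ (x i)‖ := fun i => by
    rw [map_smul, norm_smul, RCLike.norm_ofReal, abs_of_pos (by positivity)]
  simp only [h1]
  have h2 := sum_rpow_le_of_hereditary (a := fun i => τ⁻¹ * ‖φ (x i)‖)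
    (fun i => by positivity) (C := 2 * D * ‖φ‖) (t := t) (r := r) (by positivity) (by linarith)
    hr hγ S fun K hK => by
      rcases K.eq_empty_or_nonempty with rfl | hne
      · simp; positivity
      have h3 := le_of_rpow_le_mul ht0 (signMax_nonneg x K) (by positivity) hτ.le
        (by positivity) (hher K (hK.trans hS) hne)
      rw [← Finset.mul_sum, inv_mul_le_iff₀ hτ]
      refine (sum_norm_le_signMax φ x K).trans ?_
      refine (mul_le_mul_of_nonneg_left h3 (by positivity)).trans (le_of_eq ?_)
      ring
  refine h2.trans (le_of_eq ?_)
  rw [hSc, Real.mul_rpow (by positivity) (norm_nonneg _)]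
  ring

end WeakNorm

/-! ### Uniform boundedness in ℓ_ρ -/

section Uniform

variable {𝕜 : Type*} [RCLike 𝕜]

/-- Uniform boundedness principle for maps into `ℓ_ρ`, `0 < ρ ≤ 1`. -/
theorem exists_sum_rpow_le_of_summable {E ι : Type*} [NormedAddCommGroup E] [NormedSpace 𝕜 E]
    [CompleteSpace E] (f : ι → E →L[𝕜] 𝕜) {ρ : ℝ} (hρ : 0 < ρ) (hρ1 : ρ ≤ 1)
    (h : ∀ A, Summable fun j => ‖f j A‖ ^ ρ) :
    ∃ C : ℝ, 0 ≤ C ∧ ∀ A (F : Finset ι), ∑ j ∈ F, ‖f j A‖ ^ ρ ≤ C * ‖A‖ ^ ρ := by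
  let T : ℕ → Set E := fun N => ⋂ F : Finset ι, {A | ∑ j ∈ F, ‖f j A‖ ^ ρ ≤ N}
  have hTc : ∀ N, IsClosed (T N) := fun N => isClosed_iInter fun F =>
    isClosed_le (continuous_finsetSum _ fun j _ =>
      (f j).continuous.norm.rpow_const fun _ => Or.inr hρ.le) continuous_const
  have hTU : ⋃ N, T N = Set.univ := by
    refine Set.eq_univ_of_forall fun A => Set.mem_iUnion.2 ?_
    obtain ⟨N, hN⟩ := exists_nat_ge (∑' j, ‖f j A‖ ^ ρ)
    exact ⟨N, Set.mem_iInter.2 fun F =>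
      ((h A).sum_le_tsum F fun _ _ => by positivity).trans hN⟩
  obtain ⟨N, A₀, hA₀⟩ := nonempty_interior_of_iUnion_of_closed hTc hTU
  obtain ⟨δ, hδ, hball⟩ := Metric.mem_nhds_iff.1 (mem_interior_iff_mem_nhds.1 hA₀)
  have hT : ∀ A ∈ T N, ∀ F : Finset ι, ∑ j ∈ F, ‖f j A‖ ^ ρ ≤ N := fun A hA F =>
    Set.mem_iInter.1 hA F
  -- Write A as (A₀ + A) - A₀; subadditivity of u ↦ u^ρ for ρ ≤ 1 replaces the triangle inequality.
  have hsmall : ∀ A, ‖A‖ < δ → ∀ F : Finset ι, ∑ j ∈ F, ‖f j A‖ ^ ρ ≤ 2 * N := by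
    intro A hA F
    have h1 := hT (A₀ + A) (hball (by simpa using hA)) F
    have h2 := hT A₀ (hball (Metric.mem_ball_self hδ)) F
    have h3 : ∑ j ∈ F, ‖f j A‖ ^ ρ ≤ ∑ j ∈ F, (‖f j (A₀ + A)‖ ^ ρ + ‖f j A₀‖ ^ ρ) := by
      refine Finset.sum_le_sum fun j _ => ?_
      refine le_trans (Real.rpow_le_rpow (norm_nonneg _) ?_ hρ.le)
        (Real.rpow_add_le_add_rpow (norm_nonneg _) (norm_nonneg _) hρ.le hρ1)
      have : f j A = f j (A₀ + A) - f j A₀ := by simp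
      rw [this]
      exact norm_sub_le _ _
    rw [Finset.sum_add_distrib] at h3
    linarith
  refine ⟨2 * N / (δ / 2) ^ ρ, by positivity, fun A F => ?_⟩
  rcases eq_or_ne A 0 with rfl | hA
  · simp [Real.zero_rpow hρ.ne']
  have hA0 : 0 < ‖A‖ := norm_pos_iff.2 hA
  set c : ℝ := δ / 2 / ‖A‖ with hc
  have hc0 : 0 < c := by positivity
  have h1 := hsmall ((c : 𝕜) • A) (by
    rw [norm_smul, RCLike.norm_ofReal, abs_of_pos hc0, hc, div_mul_cancel₀ _ hA0.ne']
    linarith) F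
  have h2 : ∀ j, ‖f j ((c : 𝕜) • A)‖ ^ ρ = c ^ ρ * ‖f j A‖ ^ ρ := fun j => by
    rw [map_smul, norm_smul, RCLike.norm_ofReal, abs_of_pos hc0,
      Real.mul_rpow hc0.le (norm_nonneg _)]
  simp only [h2] at h1
  rw [← Finset.mul_sum, hc, Real.div_rpow (by positivity) hA0.le, div_mul_eq_mul_div,
    div_le_iff₀ (by positivity)] at h1
  rw [div_mul_eq_mul_div, le_div_iff₀ (by positivity)]
  linarith

end Uniform

/-! ### Random diagonal forms and the contradiction -/

section Forms

variable {𝕜 X : Type*} [RCLike 𝕜] [NormedAddCommGroup X] [NormedSpace 𝕜 X]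

/-- Averaging the forms `∑ j, ε j φ j ⊗ φ j` over all signs, where `φ j` norms `x j`. -/
theorem card_rpow_le_of_forall_form {n : ℕ} (x : Fin n → X) {S : Finset (Fin n)}
    (hx : ∀ i ∈ S, 1 ≤ ‖x i‖) {C ρ : ℝ} (hC : 0 ≤ C) (hρ : 0 < ρ) (hρ1 : ρ ≤ 1)
    (h : ∀ A : X →L[𝕜] X →L[𝕜] 𝕜, ∑ i ∈ S, ‖A (x i) (x i)‖ ^ ρ ≤ C * ‖A‖ ^ ρ) :
    (S.card : ℝ) ≤ 2 * C * (S.card : ℝ) ^ ρ := by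
  classical
  choose φ hφ1 hφ using fun j => exists_dual_vector'' 𝕜 (x j)
  let T : Fin n → X →L[𝕜] X →L[𝕜] 𝕜 := fun j => (φ j).smulRight (φ j)
  let A : (Fin n → ℤˣ) → X →L[𝕜] X →L[𝕜] 𝕜 := fun θ =>
    ∑ j ∈ S, (θ j : ℤ) • T j
  have hA : ∀ θ i, A θ (x i) (x i) = ∑ j ∈ S, ((θ j : ℤ) : 𝕜) * (φ j (x i)) ^ 2 := by
    intro θ i
    simp only [A, T, sum_apply]
    refine Finset.sum_congr rfl fun j _ => ?_
    rcases Int.units_eq_one_or (θ j) with h | h <;> simp [h, sq]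
  have hAn : ∀ θ, ‖A θ‖ ≤ S.card := by
    intro θ
    refine (norm_sum_le S fun j => (θ j : ℤ) • T j).trans ?_
    calc ∑ j ∈ S, ‖(θ j : ℤ) • T j‖ ≤ ∑ j ∈ S, (1 : ℝ) :=
          Finset.sum_le_sum fun j _ => by
            refine (norm_units_smul (θ j) (T j)).trans_le ?_
            refine (ContinuousLinearMap.norm_smulRight_apply (φ j) (φ j)).trans_le ?_
            exact mul_le_one₀ (hφ1 j) (norm_nonneg _) (hφ1 j)
      _ = S.card := by simp
  have hlow : ∀ i ∈ S, (2 : ℝ) ^ n ≤ 2 * ∑ θ, ‖A θ (x i) (x i)‖ ^ ρ := by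
    intro i hi
    set δ : Fin n → ℤˣ := Function.update 1 i (-1) with hδ
    -- Flipping θ_i changes the value at (x_i, x_i) by 2φ_i(x_i)², of modulus at least 2, so the two
    -- values cannot both be small.
    have hpair : ∀ θ : Fin n → ℤˣ,
        (1 : ℝ) ≤ ‖A θ (x i) (x i)‖ ^ ρ + ‖A (θ * δ) (x i) (x i)‖ ^ ρ := by
      intro θ
      have h1 : A θ (x i) (x i) - A (θ * δ) (x i) (x i)
          = 2 * (((θ i : ℤ) : 𝕜) * (φ i (x i)) ^ 2) := by
        rw [hA, hA, ← Finset.sum_sub_distrib, Finset.sum_eq_single_of_mem i hi]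
        · simp [hδ]; ring
        · intro j _ hj
          simp [hδ, hj]
      have h2 : (1 : ℝ) ≤ ‖A θ (x i) (x i)‖ + ‖A (θ * δ) (x i) (x i)‖ := by
        refine le_trans ?_ (norm_sub_le _ _)
        have h3 : ‖((θ i : ℤ) : 𝕜)‖ = 1 := by
          rcases Int.units_eq_one_or (θ i) with h | h <;> simp [h]
        rw [h1, norm_mul, norm_mul, h3, hφ, norm_pow, RCLike.norm_ofReal, abs_norm,
          RCLike.norm_ofNat]
        nlinarith [hx i hi]
      exact (Real.one_le_rpow h2 hρ.le).trans
        (Real.rpow_add_le_add_rpow (norm_nonneg _) (norm_nonneg _) hρ.le hρ1)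
    have := Finset.sum_le_sum fun θ (_ : θ ∈ (Finset.univ : Finset (Fin n → ℤˣ))) => hpair θ
    rw [Finset.sum_add_distrib, sum_signs_mul δ fun θ => ‖A θ (x i) (x i)‖ ^ ρ,
      Finset.sum_const, Finset.card_univ, card_signs, nsmul_eq_mul, mul_one] at this
    push_cast at this
    linarith
  have hup : ∑ θ, ∑ i ∈ S, ‖A θ (x i) (x i)‖ ^ ρ ≤ 2 ^ n * (C * (S.card : ℝ) ^ ρ) := by
    calc ∑ θ, ∑ i ∈ S, ‖A θ (x i) (x i)‖ ^ ρ
        ≤ ∑ _θ : Fin n → ℤˣ, C * (S.card : ℝ) ^ ρ := Finset.sum_le_sum fun θ _ =>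
          (h (A θ)).trans (mul_le_mul_of_nonneg_left
            (Real.rpow_le_rpow (norm_nonneg (A θ)) (hAn θ) hρ.le) hC)
      _ = _ := by
        rw [Finset.sum_const, Finset.card_univ, card_signs, nsmul_eq_mul]
        push_cast
        ring
  have hsum := Finset.sum_le_sum hlow
  rw [Finset.sum_const, nsmul_eq_mul, ← Finset.mul_sum, Finset.sum_comm] at hsum
  have h2n : (0 : ℝ) < 2 ^ n := by positivity
  refine le_of_mul_le_mul_right ?_ h2n
  linarith

/-- The blocks `a k • x k i`, `i ∈ S k`, as a doubly indexed family padded with zeros. -/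
noncomputable def blockFamily {n : ℕ → ℕ} (a : ℕ → 𝕜) (x : ∀ k, Fin (n k) → X)
    (S : ∀ k, Finset (Fin (n k))) (p : ℕ × ℕ) : X :=
  open Classical in
  if h : p.2 < n p.1 then if (⟨p.2, h⟩ : Fin (n p.1)) ∈ S p.1 then a p.1 • x p.1 ⟨p.2, h⟩ else 0
  else 0

theorem blockFamily_of_mem {n : ℕ → ℕ} (a : ℕ → 𝕜) (x : ∀ k, Fin (n k) → X)
    (S : ∀ k, Finset (Fin (n k))) {k : ℕ} {i : Fin (n k)} (hi : i ∈ S k) :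
    blockFamily a x S (k, i) = a k • x k i := by
  simp [blockFamily, hi]

theorem summable_blockFamily {n : ℕ → ℕ} (a : ℕ → 𝕜) (x : ∀ k, Fin (n k) → X)
    (S : ∀ k, Finset (Fin (n k))) {r : ℝ} (hr : 0 < r) (φ : X →L[𝕜] 𝕜)
    (h : Summable fun k => ∑ i ∈ S k, ‖φ (a k • x k i)‖ ^ r) :
    Summable fun p => ‖φ (blockFamily a x S p)‖ ^ r := by
  classical
  have hzero : ∀ k, ∀ i ∉ Finset.range (n k), ‖φ (blockFamily a x S (k, i))‖ ^ r = 0 := by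
    intro k i hi
    rw [Finset.mem_range] at hi
    simp [blockFamily, hi, Real.zero_rpow hr.ne']
  rw [summable_prod_of_nonneg fun _ => by positivity]
  refine ⟨fun k => summable_of_ne_finset_zero (hzero k), ?_⟩
  refine h.congr fun k => ?_
  rw [tsum_eq_sum (hzero k), Finset.sum_range, ← Finset.sum_subset (Finset.subset_univ (S k))]
  · exact Finset.sum_congr rfl fun i hi => by rw [blockFamily_of_mem a x S hi]
  · intro i _ hi
    simp [blockFamily, hi, Real.zero_rpow hr.ne']

/-- Evaluation of bilinear forms at `(v, v)`. -/
noncomputable def evalDiag (𝕜 : Type*) {X : Type*} [RCLike 𝕜] [NormedAddCommGroup X]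
    [NormedSpace 𝕜 X] (v : X) : (X →L[𝕜] X →L[𝕜] 𝕜) →L[𝕜] 𝕜 :=
  (ContinuousLinearMap.apply 𝕜 𝕜 v).comp (ContinuousLinearMap.apply 𝕜 (X →L[𝕜] 𝕜) v)

theorem evalDiag_apply (v : X) (A : X →L[𝕜] X →L[𝕜] 𝕜) : evalDiag 𝕜 v A = A v v := rfl

/-- On a space without cotype `s > 2`, for every `r < 2` some form is not `r`-dominated. -/
theorem exists_not_isDominated {s r : ℝ} (hs : 2 < s) (h : ¬ HasCotype X s) (hr : 0 < r)
    (hr2 : r < 2) : ∃ A : X →L[𝕜] X →L[𝕜] 𝕜, ¬ IsDominated r A := by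
  by_contra! hdom
  obtain ⟨C, γ, hC, hγ, hx⟩ := exists_weak_norm_le 𝕜 hs h hr hr2
  have hη : 0 < 1 - r / 2 - γ := by linarith
  -- The gain 4^k must beat the factor 2^k lost to the weights that make the blocks summable.
  have hM : ∀ k : ℕ, ∃ M : ℕ, 0 < M ∧ (4 : ℝ) ^ k ≤ (M : ℝ) ^ (1 - r / 2 - γ) := by
    intro k
    have h1 := ((tendsto_rpow_atTop hη).comp tendsto_natCast_atTop_atTop).eventually_ge_atTop
      ((4 : ℝ) ^ k)
    obtain ⟨M, hM, hM0⟩ := (h1.and (Filter.eventually_gt_atTop 0)).exists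
    exact ⟨M, hM0, hM⟩
  choose M hM0 hM using hM
  choose n x S hS hnorm hweak using fun k => hx (M k)
  have hMpos : ∀ k, (0 : ℝ) < M k := fun k => Nat.cast_pos.2 (hM0 k)
  -- With this scaling block k contributes at most C‖φ‖^r 2^(-k) to the weak r-sum.
  set a : ℕ → ℝ := fun k => ((2 ^ k)⁻¹ * (M k : ℝ) ^ (-γ)) ^ (1 / r) with ha
  have ha0 : ∀ k, 0 < a k := fun k => by
    have := hMpos k
    simp only [ha]
    positivity
  have har : ∀ k, a k ^ r = (2 ^ k)⁻¹ * (M k : ℝ) ^ (-γ) := fun k => by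
    have := hMpos k
    simp only [ha]
    rw [← Real.rpow_mul (by positivity), one_div_mul_cancel hr.ne', Real.rpow_one]
  set z : ℕ × ℕ → X := blockFamily (fun k => (a k : 𝕜)) x S with hz
  have hzweak : WeaklySummable 𝕜 r fun j => z (Nat.pairEquiv.symm j) := by
    intro φ
    refine (Nat.pairEquiv.symm.summable_iff (f := fun p => ‖φ (z p)‖ ^ r)).2 ?_
    refine summable_blockFamily _ _ _ hr φ ?_
    refine Summable.of_nonneg_of_le (fun k => Finset.sum_nonneg fun _ _ => by positivity)
      (fun k => ?_) ((summable_geometric_two).mul_left (C * ‖φ‖ ^ r))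
    have h1 : ∀ i, ‖φ ((a k : 𝕜) • x k i)‖ ^ r = a k ^ r * ‖φ (x k i)‖ ^ r := fun i => by
      rw [map_smul, norm_smul, RCLike.norm_ofReal, abs_of_pos (ha0 k),
        Real.mul_rpow (ha0 k).le (norm_nonneg _)]
    simp only [h1]
    rw [← Finset.mul_sum]
    refine (mul_le_mul_of_nonneg_left (hweak k φ)
      (Real.rpow_nonneg (ha0 k).le r)).trans (le_of_eq ?_)
    have h2 : (M k : ℝ) ^ (-γ) * (M k : ℝ) ^ γ = 1 := by
      rw [← Real.rpow_add (hMpos k), neg_add_cancel, Real.rpow_zero]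
    rw [har, one_div, inv_pow]
    linear_combination ((2 ^ k)⁻¹ * C * ‖φ‖ ^ r) * h2
  obtain ⟨B, hB, hbound⟩ := exists_sum_rpow_le_of_summable (𝕜 := 𝕜)
    (E := X →L[𝕜] X →L[𝕜] 𝕜)
    (fun p : ℕ × ℕ => evalDiag 𝕜 (z p)) (half_pos hr) (by linarith)
    fun A => by
      simp only [evalDiag_apply]
      refine (Nat.pairEquiv.symm.summable_iff (f := fun p => ‖A (z p) (z p)‖ ^ (r / 2))).1 ?_
      exact hdom A _ _ hzweak hzweak
  simp only [evalDiag_apply] at hbound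
  have hblock : ∀ k, (2 : ℝ) ^ k ≤ 2 * B := by
    intro k
    have hMk := hMpos k
    -- Scaling both arguments by a_k multiplies |A|^(r/2) by a_k^r, hence the inverse power in the
    -- constant.
    have h1 := card_rpow_le_of_forall_form (𝕜 := 𝕜) (x k) (hnorm k) (C := B * (a k ^ r)⁻¹)
      (ρ := r / 2) (mul_nonneg hB (inv_nonneg.2 (Real.rpow_nonneg (ha0 k).le r)))
      (half_pos hr) (by linarith) fun A => by
        have h2 := hbound A ((S k).map ⟨fun i : Fin (n k) => (k, (i : ℕ)), fun i j hij => by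
          simpa [Fin.ext_iff] using hij⟩)
        rw [Finset.sum_map] at h2
        have h3 : ∀ i ∈ S k, ‖A (z (k, (i : ℕ))) (z (k, (i : ℕ)))‖ ^ (r / 2)
            = a k ^ r * ‖A (x k i) (x k i)‖ ^ (r / 2) := fun i hi => by
          rw [hz, blockFamily_of_mem _ _ _ hi]
          simp only [map_smul, smul_apply, norm_smul, RCLike.norm_ofReal,
            abs_of_pos (ha0 k)]
          rw [← mul_assoc, Real.mul_rpow (by have := ha0 k; positivity) (norm_nonneg _),
            ← sq, ← Real.rpow_natCast, ← Real.rpow_mul (ha0 k).le]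
          congr 2
          push_cast
          ring
        replace h2 := (Finset.sum_congr rfl h3).symm.trans_le h2
        rw [← Finset.mul_sum] at h2
        have := Real.rpow_pos_of_pos (ha0 k) r
        rw [mul_comm B, mul_assoc, ← div_eq_inv_mul, le_div_iff₀ this]
        linarith
    rw [hS, har, mul_inv, inv_inv, Real.rpow_neg hMk.le, inv_inv] at h1
    have h4 : (M k : ℝ) = (M k : ℝ) ^ (1 - r / 2 - γ) * ((M k : ℝ) ^ γ * (M k : ℝ) ^ (r / 2)) := by
      rw [← Real.rpow_add hMk, ← Real.rpow_add hMk, eq_comm]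
      convert Real.rpow_one (M k : ℝ) using 2
      ring
    have h5 : (M k : ℝ) ^ (1 - r / 2 - γ) ≤ 2 * B * 2 ^ k := by
      refine le_of_mul_le_mul_right ?_
        (by positivity : 0 < (M k : ℝ) ^ γ * (M k : ℝ) ^ (r / 2))
      rw [← h4]
      linarith
    have h6 : (4 : ℝ) ^ k = 2 ^ k * 2 ^ k := by rw [← mul_pow]; norm_num
    have h7 := (hM k).trans h5
    rw [h6] at h7
    exact le_of_mul_le_mul_right h7 (by positivity)
  obtain ⟨k, hk⟩ := pow_unbounded_of_one_lt (2 * B) (by norm_num : (1 : ℝ) < 2)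
  exact absurd (hblock k) (not_le.2 hk)

end Forms

/-! ### The cotype index and its conjugate exponent -/

theorem exists_not_hasCotype_of_two_lt_cot {X : Type*} [NormedAddCommGroup X]
    (h : 2 < cot X) : ∃ s : ℝ, 2 < s ∧ ¬ HasCotype X s := by
  obtain ⟨s, hs, hsc⟩ := ENNReal.lt_iff_exists_nnreal_btwn.1 h
  have hs2 : (2 : ℝ) < s := by exact_mod_cast hs
  refine ⟨s, hs2, fun hcot => ?_⟩
  have h1 : cot X ≤ ENNReal.ofReal s := iInf₂_le (s : ℝ) ⟨hs2.le, hcot⟩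
  rw [ENNReal.ofReal_coe_nnreal] at h1
  exact absurd hsc (not_lt.2 h1)

theorem conjExponent_le_two {q : ℝ≥0∞} (hq : 2 ≤ q) : ENNReal.conjExponent q ≤ 2 := by
  rw [ENNReal.conjExponent]
  have h1 : (1 : ℝ≥0∞) ≤ q - 1 := by
    rw [ENNReal.le_sub_iff_add_le_right (by simp) (le_trans (by norm_num) hq)]
    norm_num
    exact hq
  have h2 : (q - 1)⁻¹ ≤ 1 := by simpa using ENNReal.inv_le_inv.2 h1
  calc 1 + (q - 1)⁻¹ ≤ 1 + 1 := by gcongr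
    _ = 2 := by norm_num

end DominatedForms

theorem proposition2p3 {𝕜 : Type*} [RCLike 𝕜] {X : Type*} [NormedAddCommGroup X]
    [NormedSpace 𝕜 X] [CompleteSpace X] (hX : 2 < DominatedForms.cot X) :
    ENNReal.conjExponent (DominatedForms.cot X) ≤ DominatedForms.dominationIndex 𝕜 X ∧
      ∀ r : ℝ, 1 ≤ r → ENNReal.ofReal r < ENNReal.conjExponent (DominatedForms.cot X) →
        ∃ A : X →L[𝕜] X →L[𝕜] 𝕜, ¬ DominatedForms.IsDominated r A := by
  obtain ⟨s, hs, hcot⟩ := DominatedForms.exists_not_hasCotype_of_two_lt_cot hX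
  have key : ∀ r : ℝ, 0 < r → ENNReal.ofReal r < ENNReal.conjExponent (DominatedForms.cot X) →
      ∃ A : X →L[𝕜] X →L[𝕜] 𝕜, ¬ DominatedForms.IsDominated r A := by
    intro r hr hlt
    refine DominatedForms.exists_not_isDominated hs hcot hr ?_
    have h := hlt.trans_le (DominatedForms.conjExponent_le_two hX.le)
    rw [← ENNReal.ofReal_ofNat, ENNReal.ofReal_lt_ofReal_iff (by norm_num)] at h
    exact h
  refine ⟨le_iInf₂ fun r hr => ?_, fun r hr => key r (by linarith)⟩
  by_contra! hlt
  obtain ⟨A, hA⟩ := key r hr.1 hlt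
  exact hA (hr.2 A)
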